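/- Setting. Let $E_2$ be the set of nearest-neighbour edges of $\mathbb Z^2$, and write $x\sim y$ if $\{x,y\}\in E_2$. An environment is a nonnegative function $\eta=(\eta_t(e))_{t\in\mathbb R,\,e\in E_2}$ that is measurable with $\int_a^b\eta_t(e)\,dt<\infty$ for all $a<b$ and $e\in E_2$, modulo almost-everywhere equality. The space of environments carries the local $L^1$ topology (convergence means $\int_a^b|\eta^n_t(e)-\eta_t(e)|\,dt\to0$ for all $a<b$ and $e$) and its Borel $\sigma$-algebra. A random environment is a random variable $\eta$ with values in this space. It is stationary if for all $x\in\mathbb Z^2$ and $t\in\mathbb R$ the shifted environment $(\eta_{s-t}(e-x))_{s\in\mathbb R,\,e\in E_2}$ has the same law as $\eta$. Write $\mathbb P^\eta$ for conditional probability given $\eta$. A doubly-infinite random walk on $\eta$ started from the origin is a random càdlàg path $X=(X_t)_{t\in\mathbb R}$ in the one-point compactification $\mathbb Z^2\cup\{\infty\}$ such that, conditionally on $\eta$, $X_0=0$; $(X_t)_{t\ge0}$ and $(X_{-t})_{t\ge0}$ are independent; $(X_t)_{t\ge 0}$ is the minimal time-inhomogeneous Markov jump process that jumps from $x$ to each neighbour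 $y\sim x$ at rate $\eta_t(\{x,y\})$ at time $t$; and $(X_{-t})_{t\ge 0}$ is (in its finite-dimensional distributions) the minimal Markov jump process that jumps from $x$ to $y\sim x$ at rate $\eta_{-t}(\{x,y\})$ at time $t$. The process is sent to the absorbing point $\infty$ (which has infinite norm) if it explodes. Theorem 1.2. Let $\eta$ be a stationary random environment on $\mathbb Z^2$, and let $X$ and $Y$ be two doubly-infinite random walks on $\eta$, both started from the origin at time zero, that are conditionally independent given $\eta$. Suppose that for every $\varepsilon>0$ there exist $K<\infty$ and $\delta>0$ such that $$\mathbb P\Bigl(\limsup_{n\to\infty}\ \min_{0\le m\le n}\ \mathbb P^\eta\bigl(\|X_{-m}\|_2\le K\sqrt n\bigr)\ge\delta\Bigr)\ge 1-\varepsilon,$$ where $n$ and $m$ range over the nonnegative integers. Then, almost surely, the set $\{n\in\mathbb N: X_n=Y_n\in\mathbb Z^2\}$ is infinite, and, almost surely, the set $\{t\in[0,\infty): X_t=Y_t\in\mathbb Z^2\}$ has infinite Lebesgue measure. -/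

import Mathlib

open MeasureTheory ProbabilityTheory Filter Topology
open scoped ENNReal

noncomputable section

namespace DynRW

/-- The vertex set of the square lattice. -/
abbrev Z2 : Type := ℤ × ℤ

/-- The nearest-neighbour graph on the square lattice: `x ∼ y` iff their `ℓ¹` distance is one. -/
def lattice : SimpleGraph Z2 where
  Adj x y := |x.1 - y.1| + |x.2 - y.2| = 1
  symm := ⟨fun x y h => by
    rw [abs_sub_comm y.1, abs_sub_comm y.2]; exact h⟩
  loopless := ⟨fun x h => by simp at h⟩

/-- The Euclidean norm of a lattice point. -/
def euclNorm (x : Z2) : ℝ := Real.sqrt ((x.1 : ℝ) ^ 2 + (x.2 : ℝ) ^ 2)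

/-- The set of (unoriented) edges of the square lattice. -/
abbrev Edge : Type := lattice.edgeSet

/-- The edge `e - x`. -/
def Edge.sub (e : Edge) (x : Z2) : Edge :=
  ⟨Sym2.map (fun y => y - x) e.1, by
    obtain ⟨e, he⟩ := e
    induction e using Sym2.ind with
    | _ u v =>
      change |u.1 - v.1| + |u.2 - v.2| = 1 at he
      change |(u.1 - x.1) - (v.1 - x.1)| + |(u.2 - x.2) - (v.2 - x.2)| = 1
      simpa using he⟩

/-- An environment: for every edge, a nonnegative locally integrable function of time, modulo
almost-everywhere equality. -/
structure Env where
  /-- The conductance of an edge as a function of time. -/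
  cond : Edge → (ℝ →ₘ[volume] ℝ)
  locallyIntegrable : ∀ (e : Edge) (a b : ℝ), IntervalIntegrable (cond e) volume a b
  nonneg : ∀ e : Edge, ∀ᵐ t : ℝ, 0 ≤ cond e t

/-- The local `L¹` topology on environments, which is generated by the balls of the
pseudometrics `(f, g) ↦ ∫_a^b |f_t(e) - g_t(e)| dt`. -/
instance : TopologicalSpace Env :=
  TopologicalSpace.generateFrom
    {U | ∃ (g : Env) (e : Edge) (a b r : ℝ), a < b ∧ 0 < r ∧
      U = {f : Env | ∫ t in a..b, |f.cond e t - g.cond e t| < r}}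

instance : MeasurableSpace Env := borel Env

instance : BorelSpace Env := ⟨rfl⟩

/-- The space-time shift `(τ_{x,t} η)_s(e) = η_{s - t}(e - x)`. -/
def Env.shift (x : Z2) (t : ℝ) (η : Env) : Env where
  cond e := (η.cond (e.sub x)).compMeasurePreserving (fun s => s - t)
    (measurePreserving_sub_right volume t)
  locallyIntegrable e a b := by
    have h := (η.locallyIntegrable (e.sub x) (a - t) (b - t)).comp_sub_right t
    simp only [sub_add_cancel] at h
    refine h.congr_ae ?_
    exact ae_restrict_of_ae (AEEqFun.coeFn_compMeasurePreserving (η.cond (e.sub x))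
      (measurePreserving_sub_right volume t)).symm
  nonneg e := by
    filter_upwards [AEEqFun.coeFn_compMeasurePreserving (η.cond (e.sub x))
      (measurePreserving_sub_right volume t),
      (measurePreserving_sub_right volume t).quasiMeasurePreserving.ae
        (η.nonneg (e.sub x))] with s hs hs'
    rw [hs]
    exact hs'

open scoped Classical in
/-- The rate `η_t({x,y})` of jumps from `x` to `y` at time `t`; it is zero if `x` and `y` are not
neighbours. -/
def Env.rate (η : Env) (t : ℝ) (x y : Z2) : ℝ≥0∞ :=
  if h : lattice.Adj x y then ENNReal.ofReal (η.cond ⟨s(x, y), h⟩ t) else 0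

/-- For the jump process with rates `q`, the probability that a particle which is at `x` at
time `s` does not jump before time `t`. -/
def holdProb (q : ℝ → Z2 → Z2 → ℝ≥0∞) (s t : ℝ) (x : Z2) : ℝ≥0∞ :=
  ENNReal.ofReal (Real.exp (-(∫⁻ r in Set.Ioc s t, ∑' y, q r x y).toReal))

/-- For the jump process with rates `q`, the probability that a particle which is at `x` at
time `s` makes exactly `n` jumps in the time interval `(s, t]` and is at `y` at time `t`
(decomposing according to the time `r` and the target `z` of the first jump). -/
def jumpProb (q : ℝ → Z2 → Z2 → ℝ≥0∞) : ℕ → ℝ → ℝ → Z2 → Z2 → ℝ≥0∞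
  | 0, s, t, x, y => if x = y then holdProb q s t x else 0
  | n + 1, s, t, x, y =>
      ∫⁻ r in Set.Ioc s t, holdProb q s r x * ∑' z, q r x z * jumpProb q n r t z y

/-- The transition probabilities `P_{s,t}(x,y)`, `s ≤ t`, of the (minimal) time-inhomogeneous
Markov jump process with rates `q`, i.e. with generator
`L_t f(x) = ∑_y q_t(x,y) (f(y) - f(x))`. The mass lost is the probability of explosion. -/
def jumpTransition (q : ℝ → Z2 → Z2 → ℝ≥0∞) (s t : ℝ) (x y : Z2) : ℝ≥0∞ :=
  ∑' n, jumpProb q n s t x y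

/-- The transition probabilities `P^η_{s,t}(x,y)` of the doubly-infinite walk on `η`, for arbitrary
real `s` and `t`. Backwards in time (`t < s`), the walk started at `x` at time `s` is the jump
process that uses the conductances of `η` in reversed time order. -/
def Env.transition (η : Env) (s t : ℝ) (x y : Z2) : ℝ≥0∞ :=
  if s ≤ t then jumpTransition η.rate s t x y
  else jumpTransition (fun r => η.rate (-r)) (-s) (-t) x y

/-- The space of càdlàg functions from `ℝ` to the one-point compactification of the lattice. -/
structure WalkPath where
  /-- The position of the path at a given time. -/
  pos : ℝ → OnePoint Z2
  right_cont : ∀ t, ContinuousWithinAt pos (Set.Ici t) t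
  left_lim : ∀ t, ∃ l, Tendsto pos (𝓝[<] t) (𝓝 l)

/-- The σ-algebra generated by the coordinate maps, which is the Borel σ-algebra of the Skorokhod
topology. -/
instance : MeasurableSpace WalkPath :=
  ⨆ t : ℝ, (borel (OnePoint Z2)).comap (fun w => w.pos t)

/-- The set of paths that are at `x i` at time `t i` and at `y i` at time `s i` for all `i ≤ k`. -/
def cylinder (k : ℕ) (t s : ℕ → ℝ) (x y : ℕ → Z2) : Set WalkPath :=
  {w | ∀ i ≤ k, w.pos (t i) = (x i : OnePoint Z2) ∧ w.pos (s i) = (y i : OnePoint Z2)}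

variable {Ω : Type*} [MeasurableSpace Ω]

/-- The random environment `η` is stationary: `τ_{x,t} η` has the same law as `η` for all `x`
and `t`. -/
def IsStationary (μ : Measure Ω) (η : Ω → Env) : Prop :=
  ∀ (x : Z2) (t : ℝ), μ.map (fun ω => (η ω).shift x t) = μ.map η

/-- The conditional probability `P^η(A)` given the environment (a random variable). -/
def quenched (μ : Measure Ω) (η : Ω → Env) (A : Set Ω) : Ω → ℝ :=
  μ⟦A | MeasurableSpace.comap η inferInstance⟧

/-- `X` is a doubly-infinite random walk on the random environment `η`, started from the origin
at time zero: conditionally on `η`, it is a Markov process, forwards and backwards from time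
zero, whose transition probabilities are those of `η`. The times `t i` increase from zero, the times
`s i` decrease from zero; the finite-dimensional distributions below determine the conditional
law of `X` given `η`. -/
structure IsWalk (μ : Measure Ω) (η : Ω → Env) (X : Ω → WalkPath) : Prop where
  measurable : Measurable X
  law : ∀ (k : ℕ) (t s : ℕ → ℝ) (x y : ℕ → Z2), Monotone t → Antitone s → t 0 = 0 → s 0 = 0 →
    x 0 = 0 → y 0 = 0 →
    quenched μ η (X ⁻¹' cylinder k t s x y) =ᵐ[μ] fun ω =>
      ((∏ i ∈ Finset.range k, (η ω).transition (t i) (t (i + 1)) (x i) (x (i + 1))) *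
        ∏ i ∈ Finset.range k, (η ω).transition (s i) (s (i + 1)) (y i) (y (i + 1))).toReal

/-- `X` and `Y` are conditionally independent given `η`. -/
def AreCondIndep (μ : Measure Ω) (η : Ω → Env) (X Y : Ω → WalkPath) : Prop :=
  ∀ A B : Set WalkPath, MeasurableSet A → MeasurableSet B →
    quenched μ η (X ⁻¹' A ∩ Y ⁻¹' B) =ᵐ[μ]
      fun ω => quenched μ η (X ⁻¹' A) ω * quenched μ η (Y ⁻¹' B) ω

/-- The event `‖X_t‖₂ ≤ r`; the point at infinity has infinite norm. -/
def withinDist (X : Ω → WalkPath) (t r : ℝ) : Set Ω :=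
  {ω | ∃ x : Z2, (X ω).pos t = (x : OnePoint Z2) ∧ euclNorm x ≤ r}

/-- Two paths collide at time `t`: they are at the same lattice point (meeting at the point at
infinity does not count). -/
def Collide (v w : WalkPath) (t : ℝ) : Prop :=
  ∃ x : Z2, v.pos t = (x : OnePoint Z2) ∧ w.pos t = (x : OnePoint Z2)

/-- The weak diffusive estimate on the backward walk: for every `ε > 0` there are `K < ∞` and
`δ > 0` such that `P(limsup_n min_{0 ≤ m ≤ n} P^η(‖X_{-m}‖₂ ≤ K √n) ≥ δ) ≥ 1 - ε`. -/
def WeaklyDiffusive (μ : Measure Ω) (η : Ω → Env) (X : Ω → WalkPath) : Prop :=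
  ∀ ε : ℝ, 0 < ε → ∃ K δ : ℝ, 0 < δ ∧
    1 - ε ≤ μ.real {ω | δ ≤ limsup (fun n : ℕ =>
      (Finset.range (n + 1)).inf' Finset.nonempty_range_add_one fun m : ℕ =>
        quenched μ η (withinDist X (-(m : ℝ)) (K * Real.sqrt n)) ω) atTop}

end DynRW

end

/-!
Fix `ε > 0` and say that the walks *stay together* at the space-time point `(x, n)`, for an integer
time `n`, if both of them sit at `x` during `[n, n + ε)`. By right-continuity, the walks almost
surely stay together at `(0, 0)` for some `ε = 1 / (j + 1)`. So it is enough to show that, for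
fixed `ε`, almost surely there is no last space-time point at which the walks stay together: then,
once they stay together at `(0, 0)`, they do so at infinitely many integer times, which gives
infinitely many integer collisions and an infinite total collision time.

Let `A` be the event that `(0, 0)` is the last such point. By the Markov property, the probability
that `(x, k)` is the last one is the expectation of `P_{0,k}(0, x)²` times the quenched probability
of `A` in the environment seen from `(x, k)`. Stationarity moves `(x, k)` to the origin, and
reversibility (the rates are symmetric) turns the transition probability into that of the backward
walk, so this expectation is `E[1_A P_{0,-k}(0, -x)²]` (`measure_meet_relPath`). These are
probabilities of disjoint events, hence
`E[1_A ∑_k ∑_z P_{0,-k}(0, z)²] ≤ 1`.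
But the sum over `k` and `z` is almost surely infinite (`tsum_backProb_sq_eq_top`). Indeed, if the
backward walk is in the ball of radius `K √n` with probability at least `δ` at all times `k ≤ n`,
then by the Cauchy–Schwarz inequality the sum over `z` is at least of order `1 / n` at all these
times, and weak diffusivity provides such `n` arbitrarily far out. Therefore `A` is null, and by the
same formula so is the event that `(x, k)` is the last point (`measure_lastTogether`).

Neither the Chapman–Kolmogorov equations nor the absorption at infinity are needed. What is
used about the transition probabilities is that they are symmetric under time reversal
(`Env.transition_reverse`), covariant under shifts (`Env.transition_shift`) and measurable functions
of the environment (`Env.measurable_transition`).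
-/

/-! ### Jump processes: measurability, shifts and time reversal -/

namespace DynRW

theorem jumpProb_zero (q : ℝ → Z2 → Z2 → ℝ≥0∞) (s t : ℝ) (x y : Z2) :
    jumpProb q 0 s t x y = if x = y then holdProb q s t x else 0 := rfl

theorem jumpProb_succ (q : ℝ → Z2 → Z2 → ℝ≥0∞) (n : ℕ) (s t : ℝ) (x y : Z2) :
    jumpProb q (n + 1) s t x y = ∫⁻ r in Set.Ioc s t,
      holdProb q s r x * ∑' z, q r x z * jumpProb q n r t z y := rfl

theorem measurable_setLIntegral_Ioc {β : Type*} [MeasurableSpace β] {f g : β → ℝ}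
    (hf : Measurable f) (hg : Measurable g) {F : β × ℝ → ℝ≥0∞} (hF : Measurable F) :
    Measurable fun b => ∫⁻ r in Set.Ioc (f b) (g b), F (b, r) := by
  have hS : MeasurableSet {z : β × ℝ | f z.1 < z.2 ∧ z.2 ≤ g z.1} :=
    (measurableSet_lt (hf.comp measurable_fst) measurable_snd).inter
      (measurableSet_le measurable_snd (hg.comp measurable_fst))
  have h := (hF.indicator hS).lintegral_prod_right' (ν := (volume : Measure ℝ))
  have he : (fun b => ∫⁻ r in Set.Ioc (f b) (g b), F (b, r)) = fun b =>
      ∫⁻ r, {z : β × ℝ | f z.1 < z.2 ∧ z.2 ≤ g z.1}.indicator F (b, r) := by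
    funext b
    rw [← lintegral_indicator measurableSet_Ioc]
    rfl
  rw [he]
  exact h

theorem measurable_holdProb {α : Type*} [MeasurableSpace α] {q : α → ℝ → Z2 → Z2 → ℝ≥0∞}
    (hq : ∀ x y, Measurable fun p : α × ℝ => q p.1 p.2 x y) (x : Z2) :
    Measurable fun p : α × ℝ × ℝ => holdProb (q p.1) p.2.1 p.2.2 x := by
  unfold holdProb
  have h : Measurable fun p : α × ℝ × ℝ =>
      ∫⁻ r in Set.Ioc p.2.1 p.2.2, ∑' y, q p.1 r x y :=
    measurable_setLIntegral_Ioc (F := fun z : (α × ℝ × ℝ) × ℝ => ∑' y, q z.1.1 z.2 x y)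
      (by fun_prop) (by fun_prop)
      (Measurable.tsum fun y =>
        (hq x y).comp (f := fun z : (α × ℝ × ℝ) × ℝ => (z.1.1, z.2)) (by fun_prop))
  fun_prop

-- Unfolding the recursion makes unification in measurability proofs explode.
attribute [local irreducible] jumpProb holdProb

/-- Joint measurability in the two times and in a parameter of the rates. -/
theorem measurable_jumpProb {α : Type*} [MeasurableSpace α] {q : α → ℝ → Z2 → Z2 → ℝ≥0∞}
    (hq : ∀ x y, Measurable fun p : α × ℝ => q p.1 p.2 x y) (n : ℕ) (x y : Z2) :
    Measurable fun p : α × ℝ × ℝ => jumpProb (q p.1) n p.2.1 p.2.2 x y := by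
  induction n generalizing x with
  | zero =>
    by_cases h : x = y
    · simpa [jumpProb_zero, h] using measurable_holdProb hq y
    · simp [jumpProb_zero, h]
  | succ n ih =>
    simp only [jumpProb_succ]
    refine measurable_setLIntegral_Ioc
      (F := fun z : (α × ℝ × ℝ) × ℝ => holdProb (q z.1.1) z.1.2.1 z.2 x *
        ∑' w, q z.1.1 z.2 x w * jumpProb (q z.1.1) n z.2 z.1.2.2 w y) (by fun_prop) (by fun_prop) ?_
    refine Measurable.mul ((measurable_holdProb hq x).comp
      (f := fun z : (α × ℝ × ℝ) × ℝ => (z.1.1, z.1.2.1, z.2)) (by fun_prop))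
      (Measurable.tsum fun w => ?_)
    exact ((hq x w).comp (f := fun z : (α × ℝ × ℝ) × ℝ => (z.1.1, z.2)) (by fun_prop)).mul
      ((ih w).comp (f := fun z : (α × ℝ × ℝ) × ℝ => (z.1.1, z.2, z.1.2.2)) (by fun_prop))

theorem holdProb_congr_ae {q q' : ℝ → Z2 → Z2 → ℝ≥0∞} (h : ∀ᵐ r : ℝ, ∀ x y, q r x y = q' r x y)
    (s t : ℝ) (x : Z2) : holdProb q s t x = holdProb q' s t x := by
  unfold holdProb
  congr 4
  refine lintegral_congr_ae (ae_restrict_of_ae ?_)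
  filter_upwards [h] with r hr
  simp [hr]

theorem jumpProb_congr_ae {q q' : ℝ → Z2 → Z2 → ℝ≥0∞} (h : ∀ᵐ r : ℝ, ∀ x y, q r x y = q' r x y)
    (n : ℕ) (s t : ℝ) (x y : Z2) : jumpProb q n s t x y = jumpProb q' n s t x y := by
  induction n generalizing s x with
  | zero => simp only [jumpProb_zero, holdProb_congr_ae h]
  | succ n ih =>
    simp only [jumpProb_succ]
    refine lintegral_congr_ae (ae_restrict_of_ae ?_)
    filter_upwards [h] with r hr
    simp only [holdProb_congr_ae h, hr, ih]

theorem jumpTransition_congr_ae {q q' : ℝ → Z2 → Z2 → ℝ≥0∞}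
    (h : ∀ᵐ r : ℝ, ∀ x y, q r x y = q' r x y) (s t : ℝ) (x y : Z2) :
    jumpTransition q s t x y = jumpTransition q' s t x y := by
  simp only [jumpTransition, jumpProb_congr_ae h]

theorem setLIntegral_Ioc_sub (f : ℝ → ℝ≥0∞) (a b t : ℝ) :
    ∫⁻ r in Set.Ioc a b, f (r - t) = ∫⁻ r in Set.Ioc (a - t) (b - t), f r := by
  rw [← lintegral_indicator measurableSet_Ioc, ← lintegral_indicator measurableSet_Ioc,
    ← lintegral_sub_right_eq_self ((Set.Ioc (a - t) (b - t)).indicator f) t]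
  refine lintegral_congr fun r => ?_
  simp [Set.indicator_apply]

theorem setLIntegral_Ioc_neg (f : ℝ → ℝ≥0∞) (a b : ℝ) :
    ∫⁻ r in Set.Ioc (-b) (-a), f r = ∫⁻ r in Set.Ioc a b, f (-r) := by
  rw [← setLIntegral_congr (Ioo_ae_eq_Ioc (a := -b) (b := -a)),
    ← setLIntegral_congr (Ioo_ae_eq_Ioc (a := a) (b := b)),
    ← lintegral_indicator measurableSet_Ioo, ← lintegral_indicator measurableSet_Ioo,
    ← lintegral_neg_eq_self]
  refine lintegral_congr fun r => ?_
  simp [Set.indicator_apply, and_comm]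

theorem holdProb_shift (q : ℝ → Z2 → Z2 → ℝ≥0∞) (t : ℝ) (z : Z2) (s u : ℝ) (x : Z2) :
    holdProb (fun r a b => q (r - t) (a - z) (b - z)) s u x
      = holdProb q (s - t) (u - t) (x - z) := by
  unfold holdProb
  rw [← setLIntegral_Ioc_sub (fun r => ∑' y, q r (x - z) y)]
  congr 4
  refine lintegral_congr fun r => ?_
  exact (Equiv.subRight z).tsum_eq (fun y => q (r - t) (x - z) y)

/-- A process with space-time shifted rates is the shifted process. -/
theorem jumpProb_shift (q : ℝ → Z2 → Z2 → ℝ≥0∞) (t : ℝ) (z : Z2) (n : ℕ) (s u : ℝ) (x y : Z2) :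
    jumpProb (fun r a b => q (r - t) (a - z) (b - z)) n s u x y
      = jumpProb q n (s - t) (u - t) (x - z) (y - z) := by
  induction n generalizing s x with
  | zero => simp [jumpProb_zero, holdProb_shift]
  | succ n ih =>
    simp only [jumpProb_succ]
    rw [← setLIntegral_Ioc_sub]
    refine lintegral_congr fun r => ?_
    rw [holdProb_shift]
    congr 1
    rw [← (Equiv.subRight z).tsum_eq fun w => q (r - t) (x - z) w * _]
    simp only [ih, Equiv.subRight_apply]

theorem jumpTransition_shift (q : ℝ → Z2 → Z2 → ℝ≥0∞) (t : ℝ) (z : Z2) (s u : ℝ) (x y : Z2) :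
    jumpTransition (fun r a b => q (r - t) (a - z) (b - z)) s u x y
      = jumpTransition q (s - t) (u - t) (x - z) (y - z) := by
  simp only [jumpTransition, jumpProb_shift]

/-- Tonelli's theorem on the triangle `s < r < u ≤ t`. -/
theorem lintegral_triangle {G : ℝ → ℝ → ℝ≥0∞} (hG : Measurable fun p : ℝ × ℝ => G p.1 p.2)
    (s t : ℝ) :
    ∫⁻ r in Set.Ioc s t, ∫⁻ u in Set.Ioc r t, G r u
      = ∫⁻ u in Set.Ioc s t, ∫⁻ r in Set.Ioc s u, G r u := by
  have hS : MeasurableSet {p : ℝ × ℝ | s < p.1 ∧ p.1 < p.2 ∧ p.2 ≤ t} :=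
    (measurableSet_lt measurable_const measurable_fst).inter
      ((measurableSet_lt measurable_fst measurable_snd).inter
        (measurableSet_le measurable_snd measurable_const))
  have key := lintegral_lintegral_swap (μ := (volume : Measure ℝ)) (ν := (volume : Measure ℝ))
    (f := fun r u => {p : ℝ × ℝ | s < p.1 ∧ p.1 < p.2 ∧ p.2 ≤ t}.indicator
      (fun p => G p.1 p.2) (r, u)) (hG.indicator hS).aemeasurable
  have hl : ∫⁻ r in Set.Ioc s t, ∫⁻ u in Set.Ioc r t, G r u
      = ∫⁻ r, ∫⁻ u, {p : ℝ × ℝ | s < p.1 ∧ p.1 < p.2 ∧ p.2 ≤ t}.indicator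
        (fun p => G p.1 p.2) (r, u) := by
    rw [← lintegral_indicator measurableSet_Ioc]
    refine lintegral_congr fun r => ?_
    by_cases hr : s < r ∧ r ≤ t
    · rw [Set.indicator_of_mem (by exact hr), ← lintegral_indicator measurableSet_Ioc]
      refine lintegral_congr fun u => ?_
      simp [Set.indicator_apply, hr.1]
    · rw [Set.indicator_of_notMem (by exact hr)]
      refine (lintegral_eq_zero_of_ae_eq_zero (Eventually.of_forall fun u => ?_)).symm
      refine Set.indicator_of_notMem ?_ _
      rintro ⟨h1, h2, h3⟩
      exact hr ⟨h1, h2.le.trans h3⟩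
  have hr : ∫⁻ u in Set.Ioc s t, ∫⁻ r in Set.Ioc s u, G r u
      = ∫⁻ u, ∫⁻ r, {p : ℝ × ℝ | s < p.1 ∧ p.1 < p.2 ∧ p.2 ≤ t}.indicator
        (fun p => G p.1 p.2) (r, u) := by
    rw [← lintegral_indicator measurableSet_Ioc]
    refine lintegral_congr fun u => ?_
    by_cases hu : s < u ∧ u ≤ t
    · rw [Set.indicator_of_mem (by exact hu), ← setLIntegral_congr Ioo_ae_eq_Ioc,
        ← lintegral_indicator measurableSet_Ioo]
      refine lintegral_congr fun r => ?_
      simp [Set.indicator_apply, hu.2]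
    · rw [Set.indicator_of_notMem (by exact hu)]
      refine (lintegral_eq_zero_of_ae_eq_zero (Eventually.of_forall fun r => ?_)).symm
      refine Set.indicator_of_notMem ?_ _
      rintro ⟨h1, h2, h3⟩
      exact hu ⟨h1.trans h2, h3⟩
  rw [hl, hr, key]

theorem measurable_holdProb_uncurry {q : ℝ → Z2 → Z2 → ℝ≥0∞}
    (hq : ∀ x y, Measurable fun r => q r x y)
    (x : Z2) :
    Measurable fun p : ℝ × ℝ => holdProb q p.1 p.2 x :=
  (measurable_holdProb (α := Unit) (q := fun _ => q)
    (fun x y => (hq x y).comp measurable_snd) x).comp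
      (f := fun p : ℝ × ℝ => ((), p.1, p.2)) (by fun_prop)

theorem measurable_jumpProb_uncurry {q : ℝ → Z2 → Z2 → ℝ≥0∞}
    (hq : ∀ x y, Measurable fun r => q r x y)
    (n : ℕ) (x y : Z2) :
    Measurable fun p : ℝ × ℝ => jumpProb q n p.1 p.2 x y :=
  (measurable_jumpProb (α := Unit) (q := fun _ => q)
    (fun x y => (hq x y).comp measurable_snd) n x y).comp
      (f := fun p : ℝ × ℝ => ((), p.1, p.2)) (by fun_prop)

/-- The decomposition according to the time and the origin of the last jump. -/
theorem jumpProb_succ_last {q : ℝ → Z2 → Z2 → ℝ≥0∞} (hq : ∀ x y, Measurable fun r => q r x y)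
    (n : ℕ) (s t : ℝ) (x y : Z2) :
    jumpProb q (n + 1) s t x y
      = ∫⁻ r in Set.Ioc s t, ∑' z, jumpProb q n s r x z * (q r z y * holdProb q r t y) := by
  induction n generalizing s x with
  | zero =>
    simp only [jumpProb_succ, jumpProb_zero]
    refine lintegral_congr fun r => ?_
    rw [tsum_eq_single y (fun z hz => by simp [hz]),
      tsum_eq_single x (fun z hz => by simp [hz.symm])]
    simp
  | succ n ih =>
    have hH (x : Z2) := measurable_holdProb_uncurry hq x
    have hJ (x y : Z2) := measurable_jumpProb_uncurry hq n x y
    have hterm (w z : Z2) : Measurable fun p : ℝ × ℝ => holdProb q s p.1 x * (q p.1 x z *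
        (jumpProb q n p.1 p.2 z w * (q p.2 w y * holdProb q p.2 t y))) := by
      have h1 : Measurable fun p : ℝ × ℝ => holdProb q s p.1 x :=
        (hH x).comp (f := fun p : ℝ × ℝ => (s, p.1)) (by fun_prop)
      have h2 : Measurable fun p : ℝ × ℝ => holdProb q p.2 t y :=
        (hH y).comp (f := fun p : ℝ × ℝ => (p.2, t)) (by fun_prop)
      have h3 := (hq x z).comp (measurable_fst : Measurable (Prod.fst : ℝ × ℝ → ℝ))
      have h4 := (hq w y).comp (measurable_snd : Measurable (Prod.snd : ℝ × ℝ → ℝ))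
      exact h1.mul (h3.mul ((hJ z w).mul (h4.mul h2)))
    have hG : Measurable fun p : ℝ × ℝ => ∑' w, ∑' z, holdProb q s p.1 x * (q p.1 x z *
        (jumpProb q n p.1 p.2 z w * (q p.2 w y * holdProb q p.2 t y))) :=
      Measurable.tsum fun w => Measurable.tsum fun z => hterm w z
    -- Both sides are the integral over the times `r < u` of the first and the last jump, from `x`
    -- to `z` and from `w` to `y`.
    have hl : jumpProb q (n + 1 + 1) s t x y = ∫⁻ r in Set.Ioc s t, ∫⁻ u in Set.Ioc r t,
        ∑' w, ∑' z, holdProb q s r x * (q r x z *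
          (jumpProb q n r u z w * (q u w y * holdProb q u t y))) := by
      rw [jumpProb_succ]
      refine lintegral_congr fun r => ?_
      simp only [ih]
      have hsec (w z : Z2) : Measurable fun u => holdProb q s r x * (q r x z *
          (jumpProb q n r u z w * (q u w y * holdProb q u t y))) :=
        (hterm w z).comp (measurable_prodMk_left : Measurable (Prod.mk r))
      have hin (w z : Z2) : Measurable fun u =>
          jumpProb q n r u z w * (q u w y * holdProb q u t y) := by
        have h1 := (hJ z w).comp (measurable_prodMk_left : Measurable (Prod.mk r))
        have h2 : Measurable fun u => holdProb q u t y :=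
          (hH y).comp (f := fun u : ℝ => (u, t)) (by fun_prop)
        exact h1.mul ((hq w y).mul h2)
      rw [lintegral_tsum fun w => (Measurable.tsum fun z => hsec w z).aemeasurable]
      simp_rw [lintegral_tsum fun w => (hin w _).aemeasurable, ← ENNReal.tsum_mul_left]
      rw [ENNReal.tsum_comm]
      refine tsum_congr fun w => ?_
      rw [lintegral_tsum fun z => (hsec w z).aemeasurable]
      refine tsum_congr fun z => ?_
      rw [lintegral_const_mul _ ((hin w z).const_mul _), lintegral_const_mul _ (hin w z)]
    rw [hl, lintegral_triangle hG]
    refine lintegral_congr fun u => ?_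
    have hsec (w z : Z2) : Measurable fun r => holdProb q s r x * (q r x z *
        (jumpProb q n r u z w * (q u w y * holdProb q u t y))) :=
      (hterm w z).comp (measurable_prodMk_right : Measurable fun r : ℝ => (r, u))
    rw [lintegral_tsum fun w => (Measurable.tsum fun z => hsec w z).aemeasurable]
    refine tsum_congr fun w => ?_
    rw [jumpProb_succ]
    have hin : Measurable fun r => holdProb q s r x * ∑' z, q r x z * jumpProb q n r u z w := by
      have h1 : Measurable fun r => holdProb q s r x :=
        (hH x).comp (f := fun r : ℝ => (s, r)) (by fun_prop)
      exact h1.mul (Measurable.tsum fun z => (hq x z).mul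
        ((hJ z w).comp (measurable_prodMk_right : Measurable fun r : ℝ => (r, u))))
    rw [← lintegral_mul_const _ hin]
    refine lintegral_congr fun r => ?_
    rw [mul_assoc, ← ENNReal.tsum_mul_right, ENNReal.tsum_mul_left]
    simp only [mul_assoc]

/-- Time reversal: since the rates are symmetric, the jump process run backwards from `y` makes
the reversed trajectories with the same probabilities. -/
theorem jumpProb_reverse {q : ℝ → Z2 → Z2 → ℝ≥0∞} (hq : ∀ x y, Measurable fun r => q r x y)
    (hsymm : ∀ r x y, q r x y = q r y x) (n : ℕ) (s t : ℝ) (x y : Z2) :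
    jumpProb (fun r => q (-r)) n (-t) (-s) y x = jumpProb q n s t x y := by
  have hold (s t : ℝ) (x : Z2) : holdProb (fun r => q (-r)) (-t) (-s) x = holdProb q s t x := by
    unfold holdProb
    rw [setLIntegral_Ioc_neg]
    simp
  induction n generalizing t y with
  | zero =>
    by_cases h : x = y
    · subst h; simp [jumpProb_zero, hold]
    · simp [jumpProb_zero, h, Ne.symm h]
  | succ n ih =>
    rw [jumpProb_succ_last hq, jumpProb_succ, setLIntegral_Ioc_neg]
    refine lintegral_congr fun r => ?_
    rw [hold, ← ENNReal.tsum_mul_left]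
    refine tsum_congr fun z => ?_
    rw [ih, neg_neg, hsymm r y z]
    ring

theorem jumpTransition_reverse {q : ℝ → Z2 → Z2 → ℝ≥0∞} (hq : ∀ x y, Measurable fun r => q r x y)
    (hsymm : ∀ r x y, q r x y = q r y x) (s t : ℝ) (x y : Z2) :
    jumpTransition (fun r => q (-r)) (-t) (-s) y x = jumpTransition q s t x y := by
  simp only [jumpTransition, jumpProb_reverse hq hsymm]

/-! ### Transition probabilities of an environment -/

theorem jumpTransition_self (q : ℝ → Z2 → Z2 → ℝ≥0∞) (s : ℝ) (x y : Z2) :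
    jumpTransition q s s x y = if x = y then 1 else 0 := by
  rw [jumpTransition, tsum_eq_single 0]
  · simp [jumpProb_zero, holdProb]
  · intro n hn
    obtain ⟨n, rfl⟩ := Nat.exists_eq_succ_of_ne_zero hn
    simp [jumpProb_succ]

namespace Env

theorem locallyIntegrable_cond (η : Env) (e : Edge) : LocallyIntegrable (η.cond e) volume := by
  intro x
  refine ⟨Set.Icc (x - 1) (x + 1), Icc_mem_nhds (by linarith) (by linarith), ?_⟩
  exact (intervalIntegrable_iff_integrableOn_Icc_of_le (by linarith)).1
    (η.locallyIntegrable e (x - 1) (x + 1))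

theorem continuous_integral_cond (e : Edge) {a b : ℝ} (hab : a < b) :
    Continuous fun η : Env => ∫ t in a..b, η.cond e t := by
  rw [continuous_iff_continuousAt]
  intro η
  rw [ContinuousAt, Metric.tendsto_nhds]
  intro ε hε
  have ho : IsOpen {f : Env | ∫ t in a..b, |f.cond e t - η.cond e t| < ε} :=
    TopologicalSpace.isOpen_generateFrom_of_mem ⟨η, e, a, b, ε, hab, hε, rfl⟩
  filter_upwards [ho.mem_nhds (by simpa using hε)] with f hf
  rw [Real.dist_eq, ← intervalIntegral.integral_sub (f.locallyIntegrable e a b)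
    (η.locallyIntegrable e a b)]
  exact (intervalIntegral.abs_integral_le_integral_abs hab.le).trans_lt hf

open scoped Classical in
/-- A version of the rate, given by limits of averages over short time intervals; unlike the
rate itself, which depends on the chosen representatives, it is jointly measurable. -/
noncomputable def regRate (η : Env) (t : ℝ) (x y : Z2) : ℝ≥0∞ :=
  if h : lattice.Adj x y then
    limsup (fun n : ℕ => ENNReal.ofReal
      (((1 : ℝ) / (n + 1))⁻¹ * ∫ r in t..t + 1 / (n + 1), η.cond ⟨s(x, y), h⟩ r)) atTop
  else 0

theorem measurable_regRate (x y : Z2) :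
    Measurable fun p : Env × ℝ => p.1.regRate p.2 x y := by
  unfold regRate
  by_cases h : lattice.Adj x y
  · simp only [h, dite_true]
    refine Measurable.limsup fun n => ENNReal.measurable_ofReal.comp (Measurable.const_mul ?_ _)
    have hn : (0 : ℝ) < 1 / (n + 1) := by positivity
    have hu := measurable_uncurry_of_continuous_of_measurable
      (u := fun (t : ℝ) (η : Env) => ∫ r in t..t + 1 / (n + 1), η.cond ⟨s(x, y), h⟩ r)
      (fun η => ?_) (fun t => (continuous_integral_cond _ (by linarith)).measurable)
    · exact hu.comp measurable_swap
    · have hc : Continuous fun t => ∫ r in (0 : ℝ)..t, η.cond ⟨s(x, y), h⟩ r :=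
        intervalIntegral.continuous_primitive (fun a b => η.locallyIntegrable _ a b) 0
      have he : (fun t => ∫ r in t..t + 1 / (n + 1), η.cond ⟨s(x, y), h⟩ r) = fun t =>
          (∫ r in (0 : ℝ)..t + 1 / (n + 1), η.cond ⟨s(x, y), h⟩ r)
            - ∫ r in (0 : ℝ)..t, η.cond ⟨s(x, y), h⟩ r := by
        funext t
        rw [intervalIntegral.integral_interval_sub_left] <;> exact η.locallyIntegrable _ _ _
      rw [he]
      exact (hc.comp (by fun_prop)).sub hc
  · simp [h]

theorem rate_ae_eq_regRate (η : Env) : ∀ᵐ t : ℝ, ∀ x y, η.rate t x y = η.regRate t x y := by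
  rw [ae_all_iff]
  intro x
  rw [ae_all_iff]
  intro y
  by_cases h : lattice.Adj x y
  · filter_upwards [LocallyIntegrable.ae_hasDerivAt_integral
      (η.locallyIntegrable_cond ⟨s(x, y), h⟩)] with t ht
    have h1 := hasDerivAt_iff_tendsto_slope_zero.1 (ht 0)
    have h2 : Tendsto (fun n : ℕ => (1 : ℝ) / (n + 1)) atTop (𝓝[≠] 0) :=
      tendsto_nhdsWithin_iff.2 ⟨tendsto_one_div_add_atTop_nhds_zero_nat,
        Eventually.of_forall fun n => by
          have : (0 : ℝ) < 1 / (n + 1) := by positivity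
          exact this.ne'⟩
    have h3 := (ENNReal.continuous_ofReal.tendsto _).comp (h1.comp h2)
    simp only [rate, regRate, h, dite_true]
    rw [← h3.limsup_eq]
    congr 1
    funext n
    simp only [Function.comp, smul_eq_mul]
    rw [intervalIntegral.integral_interval_sub_left] <;> exact η.locallyIntegrable _ _ _
  · simp [rate, regRate, h]

/-- The transition probabilities are measurable although the rates depend on representatives,
since almost everywhere equal rates have the same transition probabilities. -/
theorem measurable_transition (s t : ℝ) (x y : Z2) :
    Measurable fun η : Env => η.transition s t x y := by
  have key {q : Env → ℝ → Z2 → Z2 → ℝ≥0∞}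
      (hq : ∀ x y, Measurable fun p : Env × ℝ => q p.1 p.2 x y) (s t : ℝ) :
      Measurable fun η : Env => jumpTransition (q η) s t x y :=
    Measurable.tsum fun n => (measurable_jumpProb hq n x y).comp
      (f := fun η : Env => (η, s, t)) (by fun_prop)
  unfold transition
  by_cases hst : s ≤ t
  · simp only [hst, if_true]
    simp_rw [fun η : Env => jumpTransition_congr_ae η.rate_ae_eq_regRate s t x y]
    exact key measurable_regRate s t
  · simp only [hst, if_false]
    have hc (η : Env) : ∀ᵐ r : ℝ, ∀ x y, η.rate (-r) x y = η.regRate (-r) x y :=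
      (Measure.measurePreserving_neg (volume : Measure ℝ)).quasiMeasurePreserving.ae
        η.rate_ae_eq_regRate
    simp_rw [fun η : Env => jumpTransition_congr_ae (hc η) (-s) (-t) x y]
    exact key (q := fun η r => η.regRate (-r)) (fun x y => (measurable_regRate x y).comp
      (f := fun p : Env × ℝ => (p.1, -p.2)) (by fun_prop)) (-s) (-t)

theorem rate_symm (η : Env) (t : ℝ) (x y : Z2) : η.rate t x y = η.rate t y x := by
  unfold rate
  by_cases h : lattice.Adj x y
  · simp only [h, h.symm, dite_true, Sym2.eq_swap]
  · have h' : ¬ lattice.Adj y x := fun h' => h h'.symm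
    simp [h, h']

theorem measurable_rate (η : Env) (x y : Z2) : Measurable fun t => η.rate t x y := by
  unfold rate
  by_cases h : lattice.Adj x y
  · simp only [h, dite_true]
    exact ENNReal.measurable_ofReal.comp (AEEqFun.measurable _)
  · simp [h]

/-- Reversibility of the walk: its transition probabilities are symmetric once the direction of
time is reversed as well. -/
theorem transition_reverse (η : Env) (s t : ℝ) (x y : Z2) :
    η.transition s t x y = η.transition t s y x := by
  have key {s t : ℝ} (hst : s < t) (x y : Z2) :
      η.transition t s y x = η.transition s t x y := by
    rw [transition, transition, if_pos hst.le, if_neg hst.not_ge,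
      jumpTransition_reverse η.measurable_rate η.rate_symm]
  rcases lt_trichotomy s t with h | rfl | h
  · exact (key h x y).symm
  · simp [transition, jumpTransition_self, eq_comm]
  · exact key h y x

theorem rate_shift_ae (η : Env) (z : Z2) (t : ℝ) :
    ∀ᵐ r : ℝ, ∀ x y, (η.shift z t).rate r x y = η.rate (r - t) (x - z) (y - z) := by
  rw [ae_all_iff]
  intro x
  rw [ae_all_iff]
  intro y
  have hadj : lattice.Adj (x - z) (y - z) ↔ lattice.Adj x y := by simp [lattice]
  by_cases h : lattice.Adj x y
  · filter_upwards [AEEqFun.coeFn_compMeasurePreserving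
      (η.cond (Edge.sub ⟨s(x, y), h⟩ z)) (measurePreserving_sub_right volume t)] with r hr
    simp only [rate, h, hadj.2 h, dite_true]
    congr 1
  · simp [rate, h, hadj]

theorem transition_shift (η : Env) (z : Z2) (t s u : ℝ) (x y : Z2) :
    (η.shift z t).transition s u x y = η.transition (s - t) (u - t) (x - z) (y - z) := by
  unfold transition
  by_cases h : s ≤ u
  · rw [if_pos h, if_pos (by linarith), jumpTransition_congr_ae (η.rate_shift_ae z t),
      jumpTransition_shift]
  · have hc : ∀ᵐ r : ℝ, ∀ x y, (η.shift z t).rate (-r) x y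
        = (fun r a b => η.rate (-(r - -t)) (a - z) (b - z)) r x y := by
      filter_upwards [(Measure.measurePreserving_neg
        (volume : Measure ℝ)).quasiMeasurePreserving.ae (η.rate_shift_ae z t)] with r hr x y
      rw [hr]
      congr 1
      ring
    rw [if_neg h, if_neg (by linarith), jumpTransition_congr_ae hc,
      jumpTransition_shift (fun r => η.rate (-r))]
    congr 1 <;> ring

end Env

/-! ### Path events and the quenched law of a walk -/

/-- The Borel σ-algebra of the one-point compactification, in which every set is measurable. -/
instance : MeasurableSpace (OnePoint Z2) := borel _

instance : BorelSpace (OnePoint Z2) := ⟨rfl⟩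

instance : Countable (OnePoint Z2) := inferInstanceAs (Countable (Option Z2))

theorem WalkPath.measurable_pos (t : ℝ) : Measurable fun w : WalkPath => w.pos t := by
  rw [measurable_iff_comap_le]
  exact le_iSup (fun t : ℝ => (borel (OnePoint Z2)).comap fun w : WalkPath => w.pos t) t

/-- The positive rational times. -/
abbrev PosRat : Type := {q : ℚ // 0 < q}

/-- Trajectories observed at positive rational times; by right-continuity they determine a
càdlàg path on the nonnegative half-line. -/
abbrev FwdPath : Type := PosRat → OnePoint Z2

/-- The trajectory of a path as seen from the space-time point `(x, k)`. -/
def relPath (k : ℕ) (x : Z2) (w : WalkPath) : FwdPath :=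
  fun t => OnePoint.map (fun z => z - x) (w.pos (k + (t : ℚ)))

theorem measurable_relPath (k : ℕ) (x : Z2) : Measurable (relPath k x) :=
  measurable_pi_lambda _ fun _ =>
    (measurable_of_countable _).comp (WalkPath.measurable_pos _)

theorem map_sub_eq_coe {x z : Z2} {p : OnePoint Z2} :
    OnePoint.map (fun y => y - x) p = (z : OnePoint Z2) ↔ p = ((x + z : Z2) : OnePoint Z2) := by
  induction p using OnePoint.rec with
  | infty => simp
  | coe p => simp [sub_eq_iff_eq_add, add_comm]

/-- The events prescribing the positions in the lattice at finitely many positive rational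
times. -/
def fwdCylinders : Set (Set FwdPath) :=
  {A | ∃ (F : Finset PosRat) (a : PosRat → Z2), A = {w | ∀ t ∈ F, w t = (a t : OnePoint Z2)}}

theorem isPiSystem_fwdCylinders : IsPiSystem fwdCylinders := by
  classical
  rintro _ ⟨F, a, rfl⟩ _ ⟨G, b, rfl⟩ ⟨w, hw1, hw2⟩
  refine ⟨F ∪ G, fun t => if t ∈ F then a t else b t, ?_⟩
  ext v
  simp only [Set.mem_inter_iff, Set.mem_ofPred_eq, Finset.mem_union]
  constructor
  · rintro ⟨h1, h2⟩ t ht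
    by_cases hF : t ∈ F
    · simpa [hF] using h1 t hF
    · simpa [hF] using h2 t (ht.resolve_left hF)
  · intro h
    refine ⟨fun t ht => by simpa [ht] using h t (Or.inl ht), fun t ht => ?_⟩
    have h' := h t (Or.inr ht)
    by_cases hF : t ∈ F
    · have hab : (a t : OnePoint Z2) = b t := (hw1 t hF).symm.trans (hw2 t ht)
      rw [h']
      simpa [hF] using hab
    · simpa [hF] using h'

theorem generateFrom_fwdCylinders :
    MeasurableSpace.generateFrom fwdCylinders = (MeasurableSpace.pi : MeasurableSpace FwdPath) := by
  refine le_antisymm (MeasurableSpace.generateFrom_le ?_) (iSup_le fun t => ?_)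
  · rintro _ ⟨F, a, rfl⟩
    simp only [Set.ofPred_forall]
    exact MeasurableSet.biInter F.countable_toSet fun t _ =>
      measurableSet_eq_fun (measurable_pi_apply t) measurable_const
  · rw [← measurable_iff_comap_le]
    have hc (z : Z2) : MeasurableSet[MeasurableSpace.generateFrom fwdCylinders]
        ((fun w : FwdPath => w t) ⁻¹' {(z : OnePoint Z2)}) :=
      MeasurableSpace.measurableSet_generateFrom ⟨{t}, fun _ => z, by ext; simp⟩
    refine @measurable_to_countable' _ _ _ _ (MeasurableSpace.generateFrom fwdCylinders) _
      fun p => ?_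
    induction p using OnePoint.rec with
    | coe z => exact hc z
    | infty =>
      have he : ((fun w : FwdPath => w t) ⁻¹' {OnePoint.infty})
          = (⋃ z : Z2, (fun w : FwdPath => w t) ⁻¹' {(z : OnePoint Z2)})ᶜ := by
        ext w
        simp only [Set.mem_preimage, Set.mem_singleton_iff, Set.mem_compl_iff, Set.mem_iUnion]
        induction w t using OnePoint.rec <;> simp
      rw [he]
      exact (MeasurableSet.iUnion hc).compl

/-- Finite sets of times are enumerated by monotone sequences. -/
theorem exists_monotone_enum (F : Finset PosRat) :
    ∃ (n : ℕ) (σ : ℕ → PosRat), Monotone σ ∧ ∀ t, t ∈ F ↔ ∃ i < n, σ i = t := by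
  induction F using Finset.induction_on_max with
  | empty => exact ⟨0, fun _ => ⟨1, one_pos⟩, monotone_const, by simp⟩
  | insert a s ha ih =>
    obtain ⟨n, σ, hσ, hs⟩ := ih
    refine ⟨n + 1, fun i => if i < n then σ i else a, fun i j hij => ?_, fun t => ?_⟩
    · dsimp only
      split_ifs with hi hj
      · exact hσ hij
      · exact (ha _ ((hs _).2 ⟨i, hi, rfl⟩)).le
      · omega
      · exact le_rfl
    · rw [Finset.mem_insert, hs]
      constructor
      · rintro (rfl | ⟨i, hi, rfl⟩)
        · exact ⟨n, by omega, by simp⟩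
        · exact ⟨i, by omega, by simp [hi]⟩
      · rintro ⟨i, hi, rfl⟩
        by_cases h : i < n
        · exact Or.inr ⟨i, h, by simp [h]⟩
        · exact Or.inl (by simp [h])

/-- The sequence of times at which a path started at time zero is observed. -/
def obsTime (σ : ℕ → PosRat) : ℕ → ℝ
  | 0 => 0
  | i + 1 => ((σ i : ℚ) : ℝ)

/-- The sequence of prescribed positions of a path started at the origin. -/
def obsPos (σ : ℕ → PosRat) (a : PosRat → Z2) : ℕ → Z2
  | 0 => 0
  | i + 1 => a (σ i)

/-- The quenched probability that the walk visits `a (σ i)` at time `σ i` for all `i < n`. -/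
noncomputable def cylProb (n : ℕ) (σ : ℕ → PosRat) (a : PosRat → Z2) (η : Env) : ℝ :=
  (∏ i ∈ Finset.range n, η.transition (obsTime σ i) (obsTime σ (i + 1))
    (obsPos σ a i) (obsPos σ a (i + 1))).toReal

theorem measurable_cylProb (n : ℕ) (σ : ℕ → PosRat) (a : PosRat → Z2) :
    Measurable (cylProb n σ a) :=
  (Finset.measurable_prod _ fun _ _ => Env.measurable_transition _ _ _ _).ennreal_toReal

theorem monotone_obsTime {σ : ℕ → PosRat} (hσ : Monotone σ) : Monotone (obsTime σ) := by
  refine monotone_nat_of_le_succ fun i => ?_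
  cases i with
  | zero => exact Rat.cast_nonneg.2 (σ 0).2.le
  | succ i => exact Rat.cast_le.2 (hσ i.le_succ)

section Quenched

variable {Ω : Type*} [MeasurableSpace Ω] {μ : Measure Ω} {η : Ω → Env}

theorem quenched_congr {A B : Set Ω} (h : A =ᵐ[μ] B) : quenched μ η A =ᵐ[μ] quenched μ η B :=
  condExp_congr_ae (indicator_ae_eq_of_ae_eq_set h)

theorem integrable_indicator_one [IsProbabilityMeasure μ] {A : Set Ω} (hA : MeasurableSet A) :
    Integrable (A.indicator fun _ => (1 : ℝ)) μ :=
  (integrable_const 1).indicator hA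

theorem quenched_nonneg (A : Set Ω) : ∀ᵐ ω ∂μ, 0 ≤ quenched μ η A ω :=
  condExp_nonneg (Eventually.of_forall fun _ => Set.indicator_nonneg (fun _ _ => zero_le_one) _)

theorem quenched_le_one [IsProbabilityMeasure μ] (hη : Measurable η)
    {A : Set Ω} (hA : MeasurableSet A) :
    ∀ᵐ ω ∂μ, quenched μ η A ω ≤ 1 := by
  have h := condExp_mono (m := MeasurableSpace.comap η inferInstance)
    (integrable_indicator_one (μ := μ) hA) (integrable_const (1 : ℝ))
    (Eventually.of_forall fun ω => Set.indicator_le_self' (fun _ _ => zero_le_one) ω)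
  rw [condExp_const hη.comap_le] at h
  exact h

theorem integral_quenched [IsProbabilityMeasure μ] (hη : Measurable η)
    {A : Set Ω} (hA : MeasurableSet A) :
    ∫ ω, quenched μ η A ω ∂μ = μ.real A :=
  integral_condExp_indicator hη hA

/-- Bounded functions of the environment can be taken out of the quenched probability. -/
theorem integral_mul_quenched [IsProbabilityMeasure μ] (hη : Measurable η)
    {A : Set Ω} (hA : MeasurableSet A)
    {g : Env → ℝ} (hg : Measurable g) (c : ℝ) (hc : ∀ᵐ ω ∂μ, ‖g (η ω)‖ ≤ c) :
    ∫ ω, g (η ω) * quenched μ η A ω ∂μ = ∫ ω in A, g (η ω) ∂μ := by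
  have hm : StronglyMeasurable[MeasurableSpace.comap η inferInstance] fun ω => g (η ω) :=
    (hg.comp (comap_measurable η)).stronglyMeasurable
  have h := condExp_stronglyMeasurable_mul_of_bound hη.comap_le hm
    (integrable_indicator_one (μ := μ) hA) c hc
  rw [← integral_indicator hA]
  calc ∫ ω, g (η ω) * quenched μ η A ω ∂μ
      = ∫ ω, (μ[(fun ω => g (η ω)) * A.indicator (fun _ => (1 : ℝ)) |
          MeasurableSpace.comap η inferInstance]) ω ∂μ := integral_congr_ae h.symm
    _ = ∫ ω, A.indicator (fun ω => g (η ω)) ω ∂μ := by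
        rw [integral_condExp hη.comap_le]
        refine integral_congr_ae (Eventually.of_forall fun ω => ?_)
        by_cases hω : ω ∈ A <;> simp [hω]

end Quenched

namespace IsWalk

variable {Ω : Type*} [MeasurableSpace Ω] {μ : Measure Ω} [IsProbabilityMeasure μ] {η : Ω → Env}
  {X : Ω → WalkPath}

theorem pos_zero (hη : Measurable η) (hX : IsWalk μ η X) :
    ∀ᵐ ω ∂μ, (X ω).pos 0 = ((0 : Z2) : OnePoint Z2) := by
  have hmeas : MeasurableSet {ω | (X ω).pos 0 = ((0 : Z2) : OnePoint Z2)} :=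
    measurableSet_eq_fun ((WalkPath.measurable_pos 0).comp hX.measurable) measurable_const
  have h := hX.law 0 (fun _ => 0) (fun _ => 0) (fun _ => 0) (fun _ => 0) monotone_const
    antitone_const rfl rfl rfl rfl
  have he : X ⁻¹' cylinder 0 (fun _ => 0) (fun _ => 0) (fun _ => 0) (fun _ => 0)
      = {ω | (X ω).pos 0 = ((0 : Z2) : OnePoint Z2)} := by
    ext ω; simp [cylinder]
  rw [he] at h
  have h1 := integral_quenched (μ := μ) hη hmeas
  rw [integral_congr_ae h] at h1
  simp only [Finset.range_zero, Finset.prod_empty, mul_one, ENNReal.toReal_one, integral_const,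
    probReal_univ, smul_eq_mul] at h1
  refine (mem_ae_iff_prob_eq_one hmeas).2 ?_
  rw [← ofReal_measureReal, ← h1, ENNReal.ofReal_one]

theorem quenched_backward (hη : Measurable η) (hX : IsWalk μ η X) (m : ℕ) (z : Z2) :
    quenched μ η {ω | (X ω).pos (-(m : ℝ)) = (z : OnePoint Z2)} =ᵐ[μ]
      fun ω => ((η ω).transition 0 (-(m : ℝ)) 0 z).toReal := by
  -- The forward half of the cylinder stays at time zero and costs the factor `P_{0,0}(0, 0) = 1`.
  have h := hX.law 1 (fun _ => 0) (fun i => if i = 0 then 0 else -(m : ℝ)) (fun _ => 0)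
    (fun i => if i = 0 then 0 else z) monotone_const
    (antitone_nat_of_succ_le fun i => by cases i <;> simp) rfl rfl rfl rfl
  refine EventuallyEq.trans (quenched_congr ?_) (h.trans (Eventually.of_forall fun ω => ?_))
  · filter_upwards [hX.pos_zero hη] with ω hω
    refine propext (?_ : (X ω).pos (-(m : ℝ)) = (z : OnePoint Z2) ↔ ∀ i ≤ 1, _)
    constructor
    · intro h0 i hi
      interval_cases i
      · exact ⟨hω, hω⟩
      · exact ⟨hω, h0⟩
    · intro h0
      exact (h0 1 le_rfl).2
  · simp [Env.transition, jumpTransition_self]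

/-- The Markov property at time `k` for events prescribing finitely many later positions, in
terms of the environment as seen from the position at time `k`. -/
theorem quenched_relPath (hη : Measurable η) (hX : IsWalk μ η X) (k : ℕ) (x : Z2) {n : ℕ}
    {σ : ℕ → PosRat} (hσ : Monotone σ) (a : PosRat → Z2) :
    quenched μ η {ω | (X ω).pos k = (x : OnePoint Z2) ∧
        ∀ i < n, relPath k x (X ω) (σ i) = (a (σ i) : OnePoint Z2)} =ᵐ[μ]
      fun ω => ((η ω).transition 0 k 0 x).toReal *
        cylProb n σ a ((η ω).shift (-x) (-(k : ℝ))) := by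
  -- The observation times are `0, k, k + σ 0, k + σ 1, …`; the backward half stays at time zero.
  have h := hX.law (n + 1) (fun i => Nat.casesOn i 0 fun j => k + obsTime σ j) (fun _ => 0)
    (fun i => Nat.casesOn i 0 fun j => x + obsPos σ a j) (fun _ => 0)
    (monotone_nat_of_le_succ fun i => by
      cases i with
      | zero => simp [obsTime]
      | succ i => simpa using monotone_obsTime hσ i.le_succ) antitone_const rfl rfl rfl rfl
  refine EventuallyEq.trans (quenched_congr ?_) (h.trans (Eventually.of_forall fun ω => ?_))
  · filter_upwards [hX.pos_zero hη] with ω hω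
    refine propext (?_ : ((X ω).pos k = (x : OnePoint Z2) ∧
        ∀ i < n, relPath k x (X ω) (σ i) = (a (σ i) : OnePoint Z2)) ↔ ∀ i ≤ n + 1, _)
    simp only [relPath, map_sub_eq_coe]
    constructor
    · rintro ⟨h0, h1⟩ i hi
      refine ⟨?_, hω⟩
      match i with
      | 0 => exact hω
      | 1 => simpa [obsTime, obsPos] using h0
      | i + 2 => exact h1 i (by omega)
    · intro h0
      refine ⟨by simpa [obsTime, obsPos] using (h0 1 (by omega)).1, fun i hi => ?_⟩
      exact (h0 (i + 2) (by omega)).1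
  · have hone : (η ω).transition 0 0 0 0 = 1 := by simp [Env.transition, jumpTransition_self]
    simp only [hone, Finset.prod_const_one, mul_one, Finset.prod_range_succ', ENNReal.toReal_mul,
      cylProb, Env.transition_shift, obsTime, obsPos, add_zero, sub_neg_eq_add]
    rw [mul_comm]
    simp only [add_comm]
    rfl

theorem quenched_relPath_zero (hη : Measurable η) (hX : IsWalk μ η X) {n : ℕ}
    {σ : ℕ → PosRat} (hσ : Monotone σ) (a : PosRat → Z2) :
    quenched μ η {ω | ∀ i < n, relPath 0 0 (X ω) (σ i) = (a (σ i) : OnePoint Z2)} =ᵐ[μ]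
      fun ω => cylProb n σ a (η ω) := by
  refine EventuallyEq.trans (quenched_congr ?_)
    ((hX.quenched_relPath hη 0 0 (n := n) hσ a).trans (Eventually.of_forall fun ω => ?_))
  · filter_upwards [hX.pos_zero hη] with ω hω
    exact propext ⟨fun h => ⟨by simpa using hω, h⟩, fun h => h.2⟩
  · have hone : (η ω).transition 0 0 0 0 = 1 := by simp [Env.transition, jumpTransition_self]
    simp [hone, cylProb, Env.transition_shift]

end IsWalk

/-! ### Meetings of two walks -/

/-- The quenched probability that the backward walk from the origin is at `z` at time `-k`. -/
noncomputable def backProb (k : ℕ) (z : Z2) (η : Env) : ℝ :=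
  (η.transition 0 (-(k : ℝ)) 0 z).toReal

theorem measurable_backProb (k : ℕ) (z : Z2) : Measurable (backProb k z) :=
  (Env.measurable_transition _ _ _ _).ennreal_toReal

/-- The point from which the walk started is, seen from `(x, k)`, at `-x` and time `-k`; by
reversibility it may equally well be reached by the backward walk. -/
theorem backProb_shift (k : ℕ) (x : Z2) (η : Env) :
    backProb k (-x) (η.shift (-x) (-(k : ℝ))) = (η.transition 0 k 0 x).toReal := by
  rw [backProb, Env.transition_shift, Env.transition_reverse]
  simp

section

theorem measurableSet_pos_eq {Ω : Type*} [MeasurableSpace Ω] {μ : Measure Ω} {η : Ω → Env}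
    {X : Ω → WalkPath} (hX : IsWalk μ η X) (t : ℝ) (p : OnePoint Z2) :
    MeasurableSet {ω | (X ω).pos t = p} :=
  measurableSet_eq_fun ((WalkPath.measurable_pos t).comp hX.measurable) measurable_const

variable {Ω : Type*} [MeasurableSpace Ω] {μ : Measure Ω} [IsProbabilityMeasure μ] {η : Ω → Env}

theorem integral_shift (hη : Measurable η) (hstat : IsStationary μ η) (x : Z2) (t : ℝ)
    {G : Env → ℝ} (hG : Measurable G) :
    ∫ ω, G ((η ω).shift x t) ∂μ = ∫ ω, G (η ω) ∂μ := by
  have hm : AEMeasurable (fun ω => (η ω).shift x t) μ := by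
    -- the law of a map which is not a.e. measurable is zero by convention
    by_contra hc
    have h := hstat x t
    rw [Measure.map_of_not_aemeasurable hc] at h
    have := Measure.isProbabilityMeasure_map (μ := μ) hη.aemeasurable
    exact IsProbabilityMeasure.ne_zero _ h.symm
  rw [← integral_map hm hG.aestronglyMeasurable, hstat x t,
    integral_map hη.aemeasurable hG.aestronglyMeasurable]

variable {X Y : Ω → WalkPath}

theorem IsWalk.backProb_nonneg_le_one (hη : Measurable η) (hX : IsWalk μ η X) (k : ℕ) (z : Z2) :
    ∀ᵐ ω ∂μ, 0 ≤ backProb k z (η ω) ∧ backProb k z (η ω) ≤ 1 := by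
  filter_upwards [hX.quenched_backward hη k z,
    quenched_le_one hη (measurableSet_pos_eq hX (-(k : ℝ)) z)] with ω h1 h2
  rw [h1] at h2
  exact ⟨ENNReal.toReal_nonneg, h2⟩

theorem IsWalk.integrable_backProb_sq (hη : Measurable η) (hX : IsWalk μ η X) (k : ℕ) (z : Z2) :
    Integrable (fun ω => backProb k z (η ω) ^ 2) μ := by
  refine Integrable.of_bound
    (((measurable_backProb k z).comp hη).pow_const 2).aestronglyMeasurable 1 ?_
  filter_upwards [hX.backProb_nonneg_le_one hη k z] with ω h
  rw [Real.norm_eq_abs, abs_of_nonneg (sq_nonneg _)]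
  exact pow_le_one₀ h.1 h.2

/-- `measure_meet_relPath` for cylinder events: by conditional independence both sides are
expectations of explicit functions of the environment, which stationarity identifies. -/
theorem measure_meet_cylinder (hη : Measurable η) (hstat : IsStationary μ η)
    (hX : IsWalk μ η X) (hY : IsWalk μ η Y) (hXY : AreCondIndep μ η X Y) (k : ℕ) (x : Z2)
    {A B : Set FwdPath} (hA : A ∈ fwdCylinders) (hB : B ∈ fwdCylinders) :
    μ ({ω | (X ω).pos k = (x : OnePoint Z2) ∧ relPath k x (X ω) ∈ A} ∩
        {ω | (Y ω).pos k = (x : OnePoint Z2) ∧ relPath k x (Y ω) ∈ B})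
      = ∫⁻ ω in {ω | relPath 0 0 (X ω) ∈ A} ∩ {ω | relPath 0 0 (Y ω) ∈ B},
          ENNReal.ofReal (backProb k (-x) (η ω) ^ 2) ∂μ := by
  have hAm : MeasurableSet A := by
    rw [← generateFrom_fwdCylinders]; exact MeasurableSpace.measurableSet_generateFrom hA
  have hBm : MeasurableSet B := by
    rw [← generateFrom_fwdCylinders]; exact MeasurableSpace.measurableSet_generateFrom hB
  have hev {C : Set FwdPath} (hC : MeasurableSet C) : MeasurableSet
      {w : WalkPath | w.pos k = (x : OnePoint Z2) ∧ relPath k x w ∈ C} :=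
    (measurableSet_eq_fun (WalkPath.measurable_pos _) measurable_const).inter
      (measurable_relPath k x hC)
  have hindep₁ := hXY _ _ (hev hAm) (hev hBm)
  have hindep₀ := hXY _ _ (measurable_relPath 0 0 hAm) (measurable_relPath 0 0 hBm)
  obtain ⟨F, a, rfl⟩ := hA
  obtain ⟨F', b, rfl⟩ := hB
  obtain ⟨n, σ, hσ, hF⟩ := exists_monotone_enum F
  obtain ⟨n', σ', hσ', hF'⟩ := exists_monotone_enum F'
  have hset (F : Finset PosRat) (a : PosRat → Z2) (n : ℕ) (σ : ℕ → PosRat)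
      (hF : ∀ t, t ∈ F ↔ ∃ i < n, σ i = t) : {w : FwdPath | ∀ t ∈ F, w t = (a t : OnePoint Z2)}
        = {w | ∀ i < n, w (σ i) = (a (σ i) : OnePoint Z2)} := by
    ext w
    constructor
    · intro h i hi
      exact h _ ((hF _).2 ⟨i, hi, rfl⟩)
    · intro h t ht
      obtain ⟨i, hi, rfl⟩ := (hF t).1 ht
      exact h i hi
  rw [hset F a n σ hF] at *
  rw [hset F' b n' σ' hF'] at *
  set S₁ := {ω | (X ω).pos k = (x : OnePoint Z2) ∧
    relPath k x (X ω) ∈ {w : FwdPath | ∀ i < n, w (σ i) = (a (σ i) : OnePoint Z2)}} ∩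
    {ω | (Y ω).pos k = (x : OnePoint Z2) ∧
    relPath k x (Y ω) ∈ {w : FwdPath | ∀ i < n', w (σ' i) = (b (σ' i) : OnePoint Z2)}} with hS₁
  set S₀ := {ω | relPath 0 0 (X ω) ∈ {w : FwdPath | ∀ i < n, w (σ i) = (a (σ i) : OnePoint Z2)}} ∩
    {ω | relPath 0 0 (Y ω) ∈ {w : FwdPath | ∀ i < n', w (σ' i) = (b (σ' i) : OnePoint Z2)}} with hS₀
  have hS₁m : MeasurableSet S₁ := (hX.measurable (hev hAm)).inter (hY.measurable (hev hBm))
  have hS₀m : MeasurableSet S₀ := (hX.measurable (measurable_relPath 0 0 hAm)).inter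
    (hY.measurable (measurable_relPath 0 0 hBm))
  have hleft : μ.real S₁ = ∫ ω, backProb k (-x) (η ω) ^ 2 *
      (cylProb n σ a (η ω) * cylProb n' σ' b (η ω)) ∂μ := by
    rw [← integral_quenched hη hS₁m, ← integral_shift hη hstat (-x) (-(k : ℝ))
      (G := fun e => backProb k (-x) e ^ 2 * (cylProb n σ a e * cylProb n' σ' b e))
      (((measurable_backProb _ _).pow_const 2).mul
        ((measurable_cylProb _ _ _).mul (measurable_cylProb _ _ _)))]
    refine integral_congr_ae ?_
    filter_upwards [hindep₁, hX.quenched_relPath hη k x (n := n) hσ a,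
      hY.quenched_relPath hη k x (n := n') hσ' b] with ω h1 h2 h3
    refine h1.trans ((congrArg₂ (· * ·) h2 h3).trans ?_)
    simp only [backProb_shift]
    ring
  have hright : ∫ ω in S₀, backProb k (-x) (η ω) ^ 2 ∂μ = ∫ ω, backProb k (-x) (η ω) ^ 2 *
      (cylProb n σ a (η ω) * cylProb n' σ' b (η ω)) ∂μ := by
    rw [← integral_mul_quenched hη hS₀m ((measurable_backProb k (-x)).pow_const 2) 1 ?_]
    · refine integral_congr_ae ?_
      filter_upwards [hindep₀, hX.quenched_relPath_zero hη (n := n) hσ a,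
        hY.quenched_relPath_zero hη (n := n') hσ' b] with ω h1 h2 h3
      congr 1
      exact h1.trans (congrArg₂ (· * ·) h2 h3)
    · filter_upwards [hX.backProb_nonneg_le_one hη k (-x)] with ω h
      rw [Real.norm_eq_abs, abs_of_nonneg (sq_nonneg _)]
      exact pow_le_one₀ h.1 h.2
  rw [← ofReal_measureReal, hleft, ← hright, ofReal_integral_eq_lintegral_ofReal
    (hX.integrable_backProb_sq hη k (-x)).integrableOn
    (Eventually.of_forall fun ω => sq_nonneg _)]

/-- The future of two walks after a meeting at the space-time point `(x, k)`: as seen from that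
point, it is distributed as the future of the walks from the origin, weighted with the square of
the probability that the backward walk goes from the origin to `-x` in time `k`. -/
theorem measure_meet_relPath (hη : Measurable η) (hstat : IsStationary μ η)
    (hX : IsWalk μ η X) (hY : IsWalk μ η Y) (hXY : AreCondIndep μ η X Y) (k : ℕ) (x : Z2)
    {A : Set (FwdPath × FwdPath)} (hA : MeasurableSet A) :
    μ {ω | ((X ω).pos k = (x : OnePoint Z2) ∧ (Y ω).pos k = (x : OnePoint Z2)) ∧
        (relPath k x (X ω), relPath k x (Y ω)) ∈ A}
      = ∫⁻ ω in {ω | (relPath 0 0 (X ω), relPath 0 0 (Y ω)) ∈ A},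
          ENNReal.ofReal (backProb k (-x) (η ω) ^ 2) ∂μ := by
  have hR (k : ℕ) (x : Z2) : Measurable fun ω => (relPath k x (X ω), relPath k x (Y ω)) :=
    ((measurable_relPath k x).comp hX.measurable).prodMk
      ((measurable_relPath k x).comp hY.measurable)
  let ν₁ := (μ.restrict {ω | (X ω).pos k = (x : OnePoint Z2) ∧
    (Y ω).pos k = (x : OnePoint Z2)}).map fun ω => (relPath k x (X ω), relPath k x (Y ω))
  let ν₂ := (μ.withDensity fun ω => ENNReal.ofReal (backProb k (-x) (η ω) ^ 2)).map
    fun ω => (relPath 0 0 (X ω), relPath 0 0 (Y ω))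
  have h₁ {A : Set (FwdPath × FwdPath)} (hA : MeasurableSet A) :
      ν₁ A = μ {ω | ((X ω).pos k = (x : OnePoint Z2) ∧ (Y ω).pos k = (x : OnePoint Z2)) ∧
        (relPath k x (X ω), relPath k x (Y ω)) ∈ A} := by
    rw [Measure.map_apply (hR k x) hA, Measure.restrict_apply (hR k x hA), Set.inter_comm]
    rfl
  have h₂ {A : Set (FwdPath × FwdPath)} (hA : MeasurableSet A) :
      ν₂ A = ∫⁻ ω in {ω | (relPath 0 0 (X ω), relPath 0 0 (Y ω)) ∈ A},
        ENNReal.ofReal (backProb k (-x) (η ω) ^ 2) ∂μ := by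
    rw [Measure.map_apply (hR 0 0) hA, withDensity_apply _ (hR 0 0 hA)]
    rfl
  have hmeas {A : Set FwdPath} (hA : A ∈ fwdCylinders) : MeasurableSet A := by
    rw [← generateFrom_fwdCylinders]; exact MeasurableSpace.measurableSet_generateFrom hA
  have huniv : (Set.univ : Set FwdPath) ∈ fwdCylinders := ⟨∅, fun _ => 0, by simp⟩
  have hspan : IsCountablySpanning fwdCylinders :=
    ⟨fun _ => Set.univ, fun _ => huniv, Set.iUnion_const _⟩
  have hprod {A B : Set FwdPath} (hA : A ∈ fwdCylinders) (hB : B ∈ fwdCylinders) :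
      ν₁ (A ×ˢ B) = ν₂ (A ×ˢ B) := by
    rw [h₁ ((hmeas hA).prod (hmeas hB)), h₂ ((hmeas hA).prod (hmeas hB))]
    convert measure_meet_cylinder hη hstat hX hY hXY k x hA hB using 2
    · ext ω
      simp only [Set.mem_prod, Set.mem_ofPred_eq, Set.mem_inter_iff]
      tauto
    · rfl
  have heq : ν₁ = ν₂ := by
    have hfin : IsFiniteMeasure ν₁ := Measure.isFiniteMeasure_map _ _
    refine ext_of_generate_finite (Set.image2 (· ×ˢ ·) fwdCylinders fwdCylinders) ?_
      (isPiSystem_fwdCylinders.prod isPiSystem_fwdCylinders) ?_ ?_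
    · rw [← generateFrom_prod_eq hspan hspan, generateFrom_fwdCylinders]
    · rintro _ ⟨A, hA, B, hB, rfl⟩
      exact hprod hA hB
    · rw [← Set.univ_prod_univ]
      exact hprod huniv huniv
  rw [← h₁ hA, ← h₂ hA, heq]

end

/-! ### Divergence of the collision sum of the backward walks -/

/-- If a sequence of functions has, for infinitely many `n`, mass at least of
constant order on a set of size of order `n` at all times up to `n`, then the sums of its squares
over space and time diverge: they are at least of order `1 / n` at all times up to `n`. -/
theorem tsum_sq_eq_top {p : ℕ → Z2 → ℝ} {B : ℕ → Finset Z2} {C δ : ℝ} (hC : 0 < C) (hδ : 0 < δ)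
    (hB : ∀ n, 1 ≤ n → ((B n).card : ℝ) ≤ C * n)
    (hfreq : ∃ᶠ n in atTop, ∀ m ≤ n, δ ≤ ∑ z ∈ B n, p m z) :
    ∑' m, ∑' z, ENNReal.ofReal (p m z ^ 2) = ⊤ := by
  by_contra hne
  have hc : 0 < δ ^ 2 / C := by positivity
  have hterm {n : ℕ} (hn : 1 ≤ n) (h : ∀ m ≤ n, δ ≤ ∑ z ∈ B n, p m z) {m : ℕ} (hm : m ≤ n) :
      ENNReal.ofReal (δ ^ 2 / C / n) ≤ ∑' z, ENNReal.ofReal (p m z ^ 2) := by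
    refine le_trans ?_ (ENNReal.sum_le_tsum (B n))
    rw [← ENNReal.ofReal_sum_of_nonneg fun _ _ => sq_nonneg _]
    refine ENNReal.ofReal_le_ofReal ?_
    have hn' : (0 : ℝ) < n := by exact_mod_cast hn
    have h1 : δ ^ 2 ≤ (∑ z ∈ B n, p m z) ^ 2 := pow_le_pow_left₀ hδ.le (h m hm) 2
    have h2 := sq_sum_le_card_mul_sum_sq (s := B n) (f := p m)
    have h3 : ((B n).card : ℝ) * ∑ z ∈ B n, p m z ^ 2 ≤ C * n * ∑ z ∈ B n, p m z ^ 2 :=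
      mul_le_mul_of_nonneg_right (hB n hn) (Finset.sum_nonneg fun _ _ => sq_nonneg _)
    rw [div_div, div_le_iff₀ (by positivity)]
    linarith
  have htail := ENNReal.tendsto_sum_nat_add _ hne
  have hpos : (0 : ℝ≥0∞) < ENNReal.ofReal (δ ^ 2 / C / 2) := ENNReal.ofReal_pos.2 (by positivity)
  -- Beyond a time `i` the sum is small, but there are at least `n / 2` times between `i` and a good
  -- `n > 2 * i`.
  obtain ⟨i, hi⟩ := (htail.eventually (gt_mem_nhds hpos)).exists
  obtain ⟨n, hn, hin⟩ := (hfreq.and_eventually (eventually_ge_atTop (2 * i + 1))).exists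
  refine absurd hi (not_lt.2 ?_)
  calc ENNReal.ofReal (δ ^ 2 / C / 2)
      ≤ ∑ _k ∈ Finset.range (n - i), ENNReal.ofReal (δ ^ 2 / C / n) := by
        rw [Finset.sum_const, Finset.card_range, nsmul_eq_mul, ← ENNReal.ofReal_natCast,
          ← ENNReal.ofReal_mul (by positivity)]
        refine ENNReal.ofReal_le_ofReal ?_
        have hn' : (0 : ℝ) < n := by exact_mod_cast (by omega : 0 < n)
        have h2 : (n : ℝ) ≤ 2 * ((n - i : ℕ) : ℝ) := by exact_mod_cast (by omega : n ≤ 2 * (n - i))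
        rw [mul_div_assoc', div_le_div_iff₀ two_pos hn']
        nlinarith
    _ ≤ ∑ k ∈ Finset.range (n - i), ∑' z, ENNReal.ofReal (p (k + i) z ^ 2) :=
        Finset.sum_le_sum fun k hk => hterm (by omega) hn
          (by have := Finset.mem_range.1 hk; omega)
    _ ≤ _ := ENNReal.sum_le_tsum _

open scoped Classical in
/-- The lattice points in the Euclidean ball of radius `r`. -/
noncomputable def latticeBall (r : ℝ) : Finset Z2 :=
  (Finset.Icc (-⌊|r|⌋) ⌊|r|⌋ ×ˢ Finset.Icc (-⌊|r|⌋) ⌊|r|⌋).filter fun z => euclNorm z ≤ r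

theorem mem_latticeBall {r : ℝ} {z : Z2} : z ∈ latticeBall r ↔ euclNorm z ≤ r := by
  rw [latticeBall, Finset.mem_filter]
  refine and_iff_right_of_imp fun h => ?_
  have key {a : ℤ} (ha : |(a : ℝ)| ≤ euclNorm z) : a ∈ Finset.Icc (-⌊|r|⌋) ⌊|r|⌋ := by
    rw [Finset.mem_Icc, ← abs_le, Int.le_floor, Int.cast_abs]
    exact ha.trans (h.trans (le_abs_self r))
  refine Finset.mem_product.2 ⟨key (Real.abs_le_sqrt ?_), key (Real.abs_le_sqrt ?_)⟩ <;> nlinarith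

theorem card_latticeBall_le (r : ℝ) : ((latticeBall r).card : ℝ) ≤ (2 * |r| + 1) ^ 2 := by
  have h0 : 0 ≤ ⌊|r|⌋ := Int.floor_nonneg.2 (abs_nonneg r)
  have h1 : ((Finset.Icc (-⌊|r|⌋) ⌊|r|⌋).card : ℝ) ≤ 2 * |r| + 1 := by
    rw [Int.card_Icc]
    have : (((⌊|r|⌋ + 1 - -⌊|r|⌋).toNat : ℤ) : ℝ) = 2 * ⌊|r|⌋ + 1 := by
      rw [Int.toNat_of_nonneg (by omega)]
      push_cast
      ring
    rw [← Int.cast_natCast, this]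
    linarith [Int.floor_le |r|]
  calc ((latticeBall r).card : ℝ)
      ≤ ((Finset.Icc (-⌊|r|⌋) ⌊|r|⌋ ×ˢ Finset.Icc (-⌊|r|⌋) ⌊|r|⌋).card : ℝ) := by
        exact_mod_cast Finset.card_filter_le _ _
    _ = ((Finset.Icc (-⌊|r|⌋) ⌊|r|⌋).card : ℝ) ^ 2 := by
        rw [Finset.card_product]; push_cast; ring
    _ ≤ (2 * |r| + 1) ^ 2 := pow_le_pow_left₀ (Nat.cast_nonneg _) h1 2

section

variable {Ω : Type*} [MeasurableSpace Ω] {μ : Measure Ω} {η : Ω → Env} {X : Ω → WalkPath}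

theorem measurableSet_withinDist (hX : IsWalk μ η X) (t r : ℝ) :
    MeasurableSet (withinDist X t r) := by
  have he : withinDist X t r = ⋃ z ∈ latticeBall r, {ω | (X ω).pos t = (z : OnePoint Z2)} := by
    ext ω
    simp [withinDist, mem_latticeBall, and_comm]
  rw [he]
  exact Finset.measurableSet_biUnion _ fun z _ => measurableSet_pos_eq hX t z

theorem quenched_withinDist [IsProbabilityMeasure μ] (hη : Measurable η)
    (hX : IsWalk μ η X) (m : ℕ) (r : ℝ) :
    quenched μ η (withinDist X (-(m : ℝ)) r) =ᵐ[μ]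
      fun ω => ∑ z ∈ latticeBall r, backProb m z (η ω) := by
  have hind : (withinDist X (-(m : ℝ)) r).indicator (fun _ => (1 : ℝ)) =
      ∑ z ∈ latticeBall r,
        {ω | (X ω).pos (-(m : ℝ)) = (z : OnePoint Z2)}.indicator fun _ => (1 : ℝ) := by
    funext ω
    rw [Finset.sum_apply]
    by_cases hω : ω ∈ withinDist X (-(m : ℝ)) r
    · obtain ⟨x, hx, hxr⟩ := hω
      rw [Finset.sum_eq_single_of_mem x (mem_latticeBall.2 hxr)]
      · rw [Set.indicator_of_mem (show ω ∈ withinDist X (-(m : ℝ)) r from ⟨x, hx, hxr⟩),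
          Set.indicator_of_mem (by exact hx)]
      · intro z _ hz
        refine Set.indicator_of_notMem (fun h => hz ?_) _
        exact OnePoint.coe_injective ((show _ = _ from h).symm.trans hx)
    · rw [Set.indicator_of_notMem hω]
      refine (Finset.sum_eq_zero fun z hz => ?_).symm
      have hz' : ω ∉ {ω | (X ω).pos (-(m : ℝ)) = (z : OnePoint Z2)} :=
        fun h => hω ⟨z, h, mem_latticeBall.1 hz⟩
      exact Set.indicator_of_notMem hz' _
  have hsum := condExp_finsetSum (μ := μ) (s := latticeBall r) (f := fun z =>
    {ω | (X ω).pos (-(m : ℝ)) = (z : OnePoint Z2)}.indicator fun _ => (1 : ℝ))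
    (fun z _ => integrable_indicator_one (measurableSet_pos_eq hX _ _))
    (MeasurableSpace.comap η inferInstance)
  have hall : ∀ᵐ ω ∂μ, ∀ z : Z2,
      quenched μ η {ω | (X ω).pos (-(m : ℝ)) = (z : OnePoint Z2)} ω = backProb m z (η ω) :=
    ae_all_iff.2 fun z => hX.quenched_backward hη m z
  rw [← hind] at hsum
  filter_upwards [hsum, hall] with ω h1 h2
  refine h1.trans ?_
  rw [Finset.sum_apply]
  exact Finset.sum_congr rfl fun z _ => h2 z

/-- In almost every environment, two independent backward walks from the origin spend an infinite
expected number of integer times together. -/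
theorem tsum_backProb_sq_eq_top [IsProbabilityMeasure μ] (hη : Measurable η) (hX : IsWalk μ η X)
    (hdiff : WeaklyDiffusive μ η X) :
    ∀ᵐ ω ∂μ, ∑' k, ∑' z, ENNReal.ofReal (backProb k z (η ω) ^ 2) = ⊤ := by
  have hGm : MeasurableSet
      {ω | ∑' k, ∑' z, ENNReal.ofReal (backProb k z (η ω) ^ 2) = ⊤} := by
    refine measurableSet_eq_fun ?_ measurable_const
    exact Measurable.tsum fun k => Measurable.tsum fun z =>
      (((measurable_backProb k z).comp hη).pow_const 2).ennreal_ofReal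
  refine (mem_ae_iff_prob_eq_one hGm).2 ?_
  rw [← ofReal_measureReal, ENNReal.ofReal_eq_one]
  refine le_antisymm measureReal_le_one (le_of_forall_pos_sub_le fun ε hε => ?_)
  obtain ⟨K, δ, hδ, hK⟩ := hdiff ε hε
  refine hK.trans ?_
  have hq : ∀ᵐ ω ∂μ, ∀ m n : ℕ,
      (0 ≤ quenched μ η (withinDist X (-(m : ℝ)) (K * Real.sqrt n)) ω ∧
        quenched μ η (withinDist X (-(m : ℝ)) (K * Real.sqrt n)) ω ≤ 1) ∧
      quenched μ η (withinDist X (-(m : ℝ)) (K * Real.sqrt n)) ω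
        = ∑ z ∈ latticeBall (K * Real.sqrt n), backProb m z (η ω) := by
    refine ae_all_iff.2 fun m => ae_all_iff.2 fun n => ?_
    filter_upwards [quenched_nonneg (μ := μ) (η := η) (withinDist X (-(m : ℝ)) (K * Real.sqrt n)),
      quenched_le_one hη (measurableSet_withinDist hX (-(m : ℝ)) (K * Real.sqrt n)),
      quenched_withinDist hη hX m (K * Real.sqrt n)] with ω h1 h2 h3
    exact ⟨⟨h1, h2⟩, h3⟩
  refine ENNReal.toReal_mono (measure_ne_top _ _) (measure_mono_ae ?_)
  filter_upwards [hq] with ω hω hlim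
  replace hlim : δ ≤ limsup (fun n : ℕ =>
      (Finset.range (n + 1)).inf' Finset.nonempty_range_add_one fun m : ℕ =>
        quenched μ η (withinDist X (-(m : ℝ)) (K * Real.sqrt n)) ω) atTop := hlim
  have hcob : IsCoboundedUnder (· ≤ ·) atTop (fun n : ℕ =>
      (Finset.range (n + 1)).inf' Finset.nonempty_range_add_one fun m : ℕ =>
        quenched μ η (withinDist X (-(m : ℝ)) (K * Real.sqrt n)) ω) :=
    isCoboundedUnder_le_of_le atTop (x := 0) fun n =>
      Finset.le_inf' _ _ fun m _ => (hω m n).1.1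
  refine tsum_sq_eq_top (B := fun n : ℕ => latticeBall (K * Real.sqrt n))
    (C := (2 * |K| + 1) ^ 2) (δ := δ / 2) (by positivity) (by positivity) (fun n hn => ?_) ?_
  · refine (card_latticeBall_le _).trans ?_
    have h1 : 1 ≤ Real.sqrt n := Real.one_le_sqrt.2 (by exact_mod_cast hn)
    rw [abs_mul, abs_of_nonneg (Real.sqrt_nonneg n)]
    calc (2 * (|K| * Real.sqrt n) + 1) ^ 2 ≤ ((2 * |K| + 1) * Real.sqrt n) ^ 2 :=
          pow_le_pow_left₀ (by positivity) (by nlinarith) 2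
      _ = (2 * |K| + 1) ^ 2 * n := by rw [mul_pow, Real.sq_sqrt (Nat.cast_nonneg n)]
  · refine (frequently_lt_of_lt_limsup hcob (b := δ / 2) (by linarith)).mono fun n hn m hm => ?_
    rw [← (hω m n).2]
    exact ((Finset.lt_inf'_iff _).1 hn m (Finset.mem_range.2 (by omega))).le

end

/-! ### Walks that stay together -/

/-- A càdlàg path that is at a lattice point at all rational times of an interval is there during
the whole interval, its left endpoint included. -/
theorem WalkPath.pos_eq_of_forall_rat (w : WalkPath) {a b : ℝ} {x : Z2}
    (h : ∀ q : ℚ, a < q → q < b → w.pos q = (x : OnePoint Z2)) {t : ℝ} (ht : t ∈ Set.Ico a b) :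
    w.pos t = (x : OnePoint Z2) := by
  by_contra hne
  have hnhds : {(x : OnePoint Z2)}ᶜ ∈ 𝓝 (w.pos t) :=
    isClosed_singleton.isOpen_compl.mem_nhds hne
  obtain ⟨u, hu, hsub⟩ := mem_nhdsGE_iff_exists_Ico_subset.1 (w.right_cont t hnhds)
  obtain ⟨q, hq1, hq2⟩ := exists_rat_btwn (lt_min hu ht.2)
  exact hsub ⟨hq1.le, hq2.trans_le (min_le_left _ _)⟩
    (h q (ht.1.trans_lt hq1) (hq2.trans_le (min_le_right _ _)))

/-- Both paths sit at `x` at all rational times in `(n, n + ε)`; by right-continuity, this amounts to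
sitting there during `[n, n + ε)`. -/
def StayTogether (ε : ℝ) (n : ℕ) (x : Z2) (v w : WalkPath) : Prop :=
  ∀ q : ℚ, (n : ℝ) < q → q < n + ε →
    v.pos q = (x : OnePoint Z2) ∧ w.pos q = (x : OnePoint Z2)

/-- The analogue of `StayTogether` for trajectories observed at positive rational times. -/
def FwdStayTogether (ε : ℝ) (n : ℕ) (x : Z2) (p : FwdPath × FwdPath) : Prop :=
  ∀ t : PosRat, (n : ℝ) < (t : ℚ) → ((t : ℚ) : ℝ) < n + ε →
    p.1 t = (x : OnePoint Z2) ∧ p.2 t = (x : OnePoint Z2)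

theorem measurableSet_fwdStayTogether (ε : ℝ) (n : ℕ) (x : Z2) :
    MeasurableSet {p | FwdStayTogether ε n x p} := by
  simp only [FwdStayTogether, Set.ofPred_forall]
  refine MeasurableSet.iInter fun t => MeasurableSet.iInter fun _ =>
    MeasurableSet.iInter fun _ => ?_
  exact (measurableSet_eq_fun ((measurable_pi_apply t).comp measurable_fst) measurable_const).inter
    (measurableSet_eq_fun ((measurable_pi_apply t).comp measurable_snd) measurable_const)

theorem fwdStayTogether_relPath (ε : ℝ) (n k : ℕ) (x z : Z2) (v w : WalkPath) :
    FwdStayTogether ε n z (relPath k x v, relPath k x w) ↔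
      StayTogether ε (k + n) (x + z) v w := by
  simp only [FwdStayTogether, StayTogether, relPath, map_sub_eq_coe]
  constructor
  · intro h q hq1 hq2
    have hn : (0 : ℝ) ≤ n := Nat.cast_nonneg n
    push_cast at hq1 hq2
    have hpos : (0 : ℚ) < q - k := by
      have : (0 : ℝ) < ((q - k : ℚ) : ℝ) := by push_cast; linarith
      exact_mod_cast this
    have h' := h ⟨q - k, hpos⟩ (by push_cast; linarith) (by push_cast; linarith)
    simpa using h'
  · intro h t ht1 ht2
    have h' := h (k + t) (by push_cast; linarith) (by push_cast; linarith)
    simpa using h'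

/-- The event that the trajectories stay together at the origin right after time zero, and do not
stay together right after any later integer time. -/
def neverAgain (ε : ℝ) : Set (FwdPath × FwdPath) :=
  {p | FwdStayTogether ε 0 0 p ∧ ∀ (n : ℕ) (z : Z2), ¬ FwdStayTogether ε (n + 1) z p}

theorem measurableSet_neverAgain (ε : ℝ) : MeasurableSet (neverAgain ε) := by
  have he : neverAgain ε = {p | FwdStayTogether ε 0 0 p} ∩
      ⋂ (n : ℕ) (z : Z2), {p | FwdStayTogether ε (n + 1) z p}ᶜ := by
    ext p
    simp [neverAgain]
  rw [he]
  exact (measurableSet_fwdStayTogether ε 0 0).inter <| MeasurableSet.iInter fun n =>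
    MeasurableSet.iInter fun z => (measurableSet_fwdStayTogether ε (n + 1) z).compl

/-- The event that `(x, k)` is the last space-time point at which the walks stay together. -/
def lastTogether {Ω : Type*} (ε : ℝ) (X Y : Ω → WalkPath) (k : ℕ) (x : Z2) : Set Ω :=
  {ω | ((X ω).pos k = (x : OnePoint Z2) ∧ (Y ω).pos k = (x : OnePoint Z2)) ∧
    (relPath k x (X ω), relPath k x (Y ω)) ∈ neverAgain ε}

theorem mem_lastTogether {Ω : Type*} {X Y : Ω → WalkPath} {ε : ℝ} (hε : 0 < ε)
    {k : ℕ} {x : Z2} {ω : Ω} :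
    ω ∈ lastTogether ε X Y k x ↔ StayTogether ε k x (X ω) (Y ω) ∧
      ∀ n > k, ∀ z, ¬ StayTogether ε n z (X ω) (Y ω) := by
  simp only [lastTogether, neverAgain, Set.mem_ofPred_eq, fwdStayTogether_relPath, add_zero]
  constructor
  · rintro ⟨_, h1, h2⟩
    refine ⟨h1, fun n hn z => ?_⟩
    obtain ⟨m, rfl⟩ := Nat.exists_eq_add_of_lt hn
    simpa [add_assoc] using h2 m (z - x)
  · rintro ⟨h1, h2⟩
    have hk : (k : ℝ) ∈ Set.Ico (k : ℝ) (k + ε) := ⟨le_rfl, by linarith⟩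
    exact ⟨⟨(X ω).pos_eq_of_forall_rat (fun q h h' => (h1 q h h').1) hk,
      (Y ω).pos_eq_of_forall_rat (fun q h h' => (h1 q h h').2) hk⟩, h1,
      fun n z => h2 _ (by omega) _⟩

/-- Almost surely, there is no last time at which the walks stay together. -/
theorem measure_lastTogether {Ω : Type*} [MeasurableSpace Ω] {μ : Measure Ω}
    [IsProbabilityMeasure μ] {η : Ω → Env} {X Y : Ω → WalkPath} (hη : Measurable η)
    (hstat : IsStationary μ η) (hX : IsWalk μ η X) (hY : IsWalk μ η Y) (hXY : AreCondIndep μ η X Y)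
    (hdiff : WeaklyDiffusive μ η X) {ε : ℝ} (hε : 0 < ε) (k : ℕ) (x : Z2) :
    μ (lastTogether ε X Y k x) = 0 := by
  set A := {ω | (relPath 0 0 (X ω), relPath 0 0 (Y ω)) ∈ neverAgain ε} with hA
  have hR (k : ℕ) (x : Z2) : Measurable fun ω => (relPath k x (X ω), relPath k x (Y ω)) :=
    ((measurable_relPath k x).comp hX.measurable).prodMk
      ((measurable_relPath k x).comp hY.measurable)
  have hmeet (k : ℕ) (x : Z2) : μ (lastTogether ε X Y k x)
      = ∫⁻ ω in A, ENNReal.ofReal (backProb k (-x) (η ω) ^ 2) ∂μ :=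
    measure_meet_relPath hη hstat hX hY hXY k x (measurableSet_neverAgain ε)
  have hmeas (k : ℕ) (x : Z2) : MeasurableSet (lastTogether ε X Y k x) :=
    ((measurableSet_pos_eq hX _ _).inter (measurableSet_pos_eq hY _ _)).inter
      (hR k x (measurableSet_neverAgain ε))
  have hdisj : Pairwise (Function.onFun Disjoint
      fun p : ℕ × Z2 => lastTogether ε X Y p.1 p.2) := by
    rintro ⟨k, x⟩ ⟨l, y⟩ hne
    refine Set.disjoint_left.2 fun ω h1 h2 => ?_
    rcases lt_trichotomy k l with hlt | rfl | hlt
    · exact ((mem_lastTogether hε).1 h1).2 l hlt y ((mem_lastTogether hε).1 h2).1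
    · exact hne (Prod.ext rfl (OnePoint.coe_injective (h1.1.1.symm.trans h2.1.1)))
    · exact ((mem_lastTogether hε).1 h2).2 k hlt x ((mem_lastTogether hε).1 h1).1
  have hg (k : ℕ) (z : Z2) : Measurable fun ω => ENNReal.ofReal (backProb k z (η ω) ^ 2) :=
    (((measurable_backProb k z).comp hη).pow_const 2).ennreal_ofReal
  have hsum : ∑' k, ∑' x, μ (lastTogether ε X Y k x) ≤ 1 := by
    rw [← ENNReal.tsum_prod (f := fun k x => μ (lastTogether ε X Y k x)),
      ← measure_iUnion hdisj fun p => hmeas p.1 p.2]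
    exact prob_le_one
  have hA0 : μ A = 0 := by
    by_contra hne
    refine absurd hsum (not_le.2 ?_)
    have htop : ∑' k, ∑' x, μ (lastTogether ε X Y k x) = ⊤ := by
      calc ∑' k, ∑' x, μ (lastTogether ε X Y k x)
          = ∑' k, ∑' z, ∫⁻ ω in A, ENNReal.ofReal (backProb k z (η ω) ^ 2) ∂μ := by
            refine tsum_congr fun k => ?_
            simp_rw [hmeet]
            exact (Equiv.neg Z2).tsum_eq
              fun z => ∫⁻ ω in A, ENNReal.ofReal (backProb k z (η ω) ^ 2) ∂μ
        _ = ∫⁻ ω in A, ∑' k, ∑' z, ENNReal.ofReal (backProb k z (η ω) ^ 2) ∂μ := by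
            rw [lintegral_tsum fun k => (Measurable.tsum fun z => hg k z).aemeasurable]
            exact tsum_congr fun k => (lintegral_tsum fun z => (hg k z).aemeasurable).symm
        _ = ∫⁻ _ in A, ⊤ ∂μ :=
            lintegral_congr_ae (ae_restrict_of_ae (tsum_backProb_sq_eq_top hη hX hdiff))
        _ = ⊤ := by rw [setLIntegral_const, ENNReal.top_mul hne]
    rw [htop]
    exact ENNReal.one_lt_top
  rw [hmeet, Measure.restrict_eq_zero.2 hA0, lintegral_zero_measure]

theorem volume_biUnion_Ico_eq_top {S : Set ℕ} (hS : S.Infinite) {ε : ℝ} (hε : 0 < ε)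
    (hε1 : ε ≤ 1) : volume (⋃ n ∈ S, Set.Ico (n : ℝ) (n + ε)) = ⊤ := by
  rw [measure_biUnion S.to_countable ?_ fun _ _ => measurableSet_Ico]
  · have : Infinite S := hS.to_subtype
    simp only [Real.volume_Ico, add_sub_cancel_left]
    exact ENNReal.tsum_const_eq_top_of_ne_zero (ENNReal.ofReal_pos.2 hε).ne'
  · intro m _ n _ hne
    have key {m n : ℕ} (h : m < n) :
        Disjoint (Set.Ico (m : ℝ) (m + ε)) (Set.Ico (n : ℝ) (n + ε)) := by
      refine Set.disjoint_left.2 fun t h1 h2 => ?_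
      have : (m : ℝ) + 1 ≤ n := by exact_mod_cast h
      linarith [h1.2, h2.1]
    rcases hne.lt_or_gt with h | h
    · exact key h
    · exact (key h).symm

theorem exists_stayTogether_zero {v w : WalkPath} (hv : v.pos 0 = ((0 : Z2) : OnePoint Z2))
    (hw : w.pos 0 = ((0 : Z2) : OnePoint Z2)) :
    ∃ j : ℕ, StayTogether (1 / ((j : ℝ) + 1)) 0 0 v w := by
  have key {w : WalkPath} (hw : w.pos 0 = ((0 : Z2) : OnePoint Z2)) :
      ∀ᶠ t in 𝓝[≥] (0 : ℝ), w.pos t = ((0 : Z2) : OnePoint Z2) := by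
    refine w.right_cont 0 (IsOpen.mem_nhds (s := {((0 : Z2) : OnePoint Z2)}) ?_ hw)
    rw [← Set.image_singleton]
    exact OnePoint.isOpenEmbedding_coe.isOpenMap _ (isOpen_discrete _)
  obtain ⟨u, hu, hsub⟩ := mem_nhdsGE_iff_exists_Ico_subset.1 ((key hv).and (key hw))
  obtain ⟨j, hj⟩ := exists_nat_one_div_lt (show (0 : ℝ) < u from hu)
  refine ⟨j, fun q hq1 hq2 => ?_⟩
  simp only [Nat.cast_zero, zero_add] at hq1 hq2
  exact hsub ⟨hq1.le, hq2.trans hj⟩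

end DynRW

theorem theorem1p2 {Ω : Type*} [MeasurableSpace Ω] (μ : Measure Ω) [IsProbabilityMeasure μ]
    (η : Ω → DynRW.Env) (hη : Measurable η) (hstat : DynRW.IsStationary μ η)
    (X Y : Ω → DynRW.WalkPath) (hX : DynRW.IsWalk μ η X) (hY : DynRW.IsWalk μ η Y)
    (hXY : DynRW.AreCondIndep μ η X Y) (hdiff : DynRW.WeaklyDiffusive μ η X) :
    (∀ᵐ ω ∂μ, {n : ℕ | DynRW.Collide (X ω) (Y ω) n}.Infinite) ∧
    (∀ᵐ ω ∂μ, volume {t : ℝ | 0 ≤ t ∧ DynRW.Collide (X ω) (Y ω) t} = ⊤) := by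
  have hε (j : ℕ) : (0 : ℝ) < 1 / ((j : ℝ) + 1) := by positivity
  have hlast : ∀ᵐ ω ∂μ, ∀ (j k : ℕ) (x : DynRW.Z2),
      ω ∉ DynRW.lastTogether (1 / ((j : ℝ) + 1)) X Y k x :=
    ae_all_iff.2 fun j => ae_all_iff.2 fun k => ae_all_iff.2 fun x =>
      measure_eq_zero_iff_ae_notMem.1
      (DynRW.measure_lastTogether hη hstat hX hY hXY hdiff (hε j) k x)
  have hmain : ∀ᵐ ω ∂μ, ∃ (ε : ℝ) (S : Set ℕ), 0 < ε ∧ ε ≤ 1 ∧ S.Infinite ∧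
      ∀ n ∈ S, ∀ t ∈ Set.Ico (n : ℝ) (n + ε), DynRW.Collide (X ω) (Y ω) t := by
    filter_upwards [hlast, hX.pos_zero hη, hY.pos_zero hη] with ω hω hX0 hY0
    obtain ⟨j, hj⟩ := DynRW.exists_stayTogether_zero hX0 hY0
    -- A nonempty finite set of times at which the walks stay together would have a maximum.
    refine ⟨1 / ((j : ℝ) + 1),
      {n | ∃ x, DynRW.StayTogether (1 / ((j : ℝ) + 1)) n x (X ω) (Y ω)}, hε j, ?_, ?_, ?_⟩
    · rw [div_le_one (by positivity)]
      linarith [(Nat.cast_nonneg j : (0 : ℝ) ≤ j)]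
    · intro hfin
      obtain ⟨k, ⟨x, hx⟩, hmax⟩ := Set.exists_max_image _ id hfin ⟨0, 0, hj⟩
      exact hω j k x ((DynRW.mem_lastTogether (hε j)).2
        ⟨hx, fun n hn z hz => (hmax n ⟨z, hz⟩).not_gt hn⟩)
    · rintro n ⟨x, hx⟩ t ht
      exact ⟨x, (X ω).pos_eq_of_forall_rat (fun q h h' => (hx q h h').1) ht,
        (Y ω).pos_eq_of_forall_rat (fun q h h' => (hx q h h').2) ht⟩
  constructor
  · filter_upwards [hmain] with ω ⟨ε, S, hε, _, hS, h⟩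
    exact hS.mono fun n hn => h n hn n ⟨le_rfl, by linarith⟩
  · filter_upwards [hmain] with ω ⟨ε, S, hε, hε1, hS, h⟩
    refine measure_mono_top ?_ (DynRW.volume_biUnion_Ico_eq_top hS hε hε1)
    refine Set.iUnion₂_subset fun n hn t ht => ⟨?_, h n hn t ht⟩
    exact (Nat.cast_nonneg n).trans ht.1
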